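/- Let $H$ be a separable complex Hilbert space of dimension at least $2$ with an orthonormal basis $\{e_i : i \in \Theta\}$, where $\Theta$ is $\{1,\dots,n\}$ with $n>1$ or $\mathbb N$, and let $(\omega_i)_{i\in\Theta}$ be positive reals with $\sum_i \omega_i = 1$. Let $\mathcal F(H)=\bigoplus_{n\ge 0} H^{\otimes n}$ (with $H^{\otimes 0}=\mathbb C\Omega$) be the full Fock space with its orthonormal basis $e_I = e_{i_1}\otimes\cdots\otimes e_{i_k}$ for words $I=i_1\cdots i_k$ over $\Theta$ ($e_{()}=\Omega$), let $l_i$ be the left creation operator $\eta\mapsto e_i\otimes\eta$, and let $P_\omega(x)=\sum_{i\in\Theta}\omega_i\, l_i^* x\, l_i$ on $B(\mathcal F(H))$. For $\lambda$ in the unit circle $\mathbb T$ let $x_\lambda$ be the unitary on $\mathcal F(H)$ with $x_\lambda e_I=\lambda^{|I|}e_I$. For a normal unital completely positive map $\tau$ on $B(L)$, $L$ a Hilbert space, put $F(\tau)=\{x:\tau(x)=x\}$ and $E_\lambda(\tau)=\{x:\tau(x)=\lambda x\}$, and let $P(\tau)$ be the norm closure of the linear span of $\bigcup_{\lambda\in\mathbb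 T}E_\lambda(\tau)$. If $(K,\mathcal B,\theta)$ is a minimal dilation of $\tau$ ($K\supseteq L$ a Hilbert space with projection $p$ onto $L$, $\mathcal B\subseteq B(K)$ a von Neumann algebra with $p\mathcal Bp=B(L)$, $\theta$ a normal unital $*$-endomorphism of $\mathcal B$ with $\tau^n(a)=p\,\theta^n(a)\,p$ for all $n \ge 0$, $K$ the closed span of the vectors $\theta^n(a_n)\cdots\theta(a_1)a_0h$ with $a_j\in B(L)$, $h\in L$, and $\mathcal B$ generated by the $\theta^n(a)$), then the compression $T:z\mapsto pzp$ is used to define $x\circ y=T(T^{-1}(x)T^{-1}(y))$ on $P(\tau)$, with $T^{-1}$ taking values in $P(\theta)$ (defined from $\theta$ on $\mathcal B$ in the same way). Then: (i) $P_\omega(x_\lambda)=\lambda x_\lambda$ for every $\lambda\in\mathbb T\setminus\{1\}$. (ii) $x_\lambda\circ x_\mu=x_\lambda x_\mu=x_{\lambda\mu}$ for all $\lambda,\mu\in\mathbb T\setminus\{1\}$, for the product of every minimal dilation of $P_\omega$; moreover $\lim_n(\lambda\mu)^{-n}P_\omega^n(x_\lambda x_\mu)=x_\lambda x_\mu$ strongly.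 (iii) For every $\lambda\in\mathbb T\setminus\{1\}$, $x_\lambda\in P(P_\omega)$ and $x_\lambda\notin F(P_\omega)$; and $F(P_\omega)\subsetneq P(P_\omega)$. (iv) For $a,b\in F(P_\omega)$ the strong limit $\lim_n P_\omega^n(ab)$ exists, lies in $F(P_\omega)$, and equals $a\circ b$ for every minimal dilation of $P_\omega$. For every minimal dilation, $T$ maps $P(\theta)$ isometrically onto $P(P_\omega)$, and $P(P_\omega)$ is a unital C*-algebra with the product $\circ$, the adjoint and the operator norm, of which $F(P_\omega)$ is a unital C*-subalgebra, proper by (iii). -/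

import Mathlib

open Filter Topology
open scoped TensorProduct ENNReal

universe u v

noncomputable section

/-! ### The full Fock space -/

/-- A bundled complex Hilbert space. -/
structure HilbertBundle : Type (u + 1) where
  carrier : Type u
  [normedAddCommGroup : NormedAddCommGroup carrier]
  [innerProductSpace : InnerProductSpace ℂ carrier]
  [completeSpace : CompleteSpace carrier]

attribute [instance] HilbertBundle.normedAddCommGroup HilbertBundle.innerProductSpace
  HilbertBundle.completeSpace

section Fock

variable (H : Type u) [NormedAddCommGroup H] [InnerProductSpace ℂ H]

/-- The Hilbert space tensor powers: `H^{⊗0} = ℂ` (as the one-dimensional Hilbert space with one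
coordinate) and `H^{⊗(n+1)}` is the completion of `H ⊗ H^{⊗n}`. -/
def tensorPow : ℕ → HilbertBundle.{u}
  | 0 => ⟨EuclideanSpace ℂ PUnit.{u + 1}⟩
  | n + 1 => ⟨UniformSpace.Completion (H ⊗[ℂ] (tensorPow n).carrier)⟩

/-- The full Fock space, the Hilbert space direct sum of the `H^{⊗n}`. -/
abbrev Fock : Type u := lp (fun n => (tensorPow H n).carrier) 2

/-- The vacuum vector. -/
def Fock.vacuum : Fock H :=
  lp.single 2 0 (EuclideanSpace.single PUnit.unit (1 : ℂ) : EuclideanSpace ℂ PUnit.{u + 1})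

variable {H}

/-- The map `η ↦ ξ ⊗ η` from `H^{⊗n}` to `H^{⊗(n+1)}`. -/
def tensorLeft (ξ : H) (n : ℕ) : (tensorPow H n).carrier →L[ℂ] (tensorPow H (n + 1)).carrier :=
  (UniformSpace.Completion.toComplL
    (𝕜 := ℂ) (E := H ⊗[ℂ] (tensorPow H n).carrier)).comp
      (TensorProduct.mkL ℂ H (tensorPow H n).carrier ξ)

theorem norm_tensorLeft (ξ : H) (n : ℕ) (η : (tensorPow H n).carrier) :
    ‖tensorLeft ξ n η‖ = ‖ξ‖ * ‖η‖ := by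
  change ‖((ξ ⊗ₜ[ℂ] η : H ⊗[ℂ] (tensorPow H n).carrier) :
    UniformSpace.Completion (H ⊗[ℂ] (tensorPow H n).carrier))‖ = _
  rw [UniformSpace.Completion.norm_coe, TensorProduct.norm_tmul]

/-- The components of `ξ ⊗ η` for `η` in the full Fock space. -/
def creationFun (ξ : H) (η : ∀ n, (tensorPow H n).carrier) : ∀ n, (tensorPow H n).carrier
  | 0 => 0
  | n + 1 => tensorLeft ξ n (η n)

theorem hasSum_creationFun (ξ : H) (η : Fock H) :
    HasSum (fun n => ‖creationFun ξ η n‖ ^ 2) (‖ξ‖ ^ 2 * ‖η‖ ^ 2) := by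
  have h := lp.hasSum_norm (p := 2) (by norm_num) η
  have h2 : HasSum (fun n => ‖η n‖ ^ 2) (‖η‖ ^ 2) := by
    simpa using h
  rw [← hasSum_nat_add_iff' 1]
  simpa [creationFun, norm_tensorLeft, mul_pow] using h2.mul_left (‖ξ‖ ^ 2)

theorem memℓp_creationFun (ξ : H) (η : Fock H) : Memℓp (creationFun ξ η) 2 := by
  refine memℓp_gen ?_
  simpa using (hasSum_creationFun ξ η).summable

/-- The left creation operator `η ↦ ξ ⊗ η`. -/
def creation (ξ : H) : Fock H →L[ℂ] Fock H :=
  LinearMap.mkContinuous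
    { toFun := fun η => ⟨creationFun ξ η, memℓp_creationFun ξ η⟩
      map_add' := by
        intro x y
        ext n
        cases n with
        | zero => exact (add_zero (0 : (tensorPow H 0).carrier)).symm
        | succ n => exact map_add (tensorLeft ξ n) (x n) (y n)
      map_smul' := by
        intro c x
        ext n
        cases n with
        | zero => exact (smul_zero (A := (tensorPow H 0).carrier) c).symm
        | succ n => exact map_smul (tensorLeft ξ n) c (x n) }
    ‖ξ‖ (by
      intro η
      refine lp.norm_le_of_tsum_le (by norm_num) (by positivity) ?_
      have h := (hasSum_creationFun ξ η).tsum_eq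
      simpa [mul_pow] using h.le)

/-- The operator `x_c` which multiplies `H^{⊗n}` by `c ^ n`. -/
def phase (c : Circle) : Fock H →L[ℂ] Fock H :=
  LinearMap.mkContinuous
    { toFun := fun η => ⟨fun n => (c : ℂ) ^ n • η n, by
        refine memℓp_gen ?_
        simpa [norm_smul, Circle.norm_coe] using (lp.memℓp η).summable (by norm_num)⟩
      map_add' := by
        intro x y
        ext n
        exact smul_add ((c : ℂ) ^ n) (x n) (y n)
      map_smul' := by
        intro a x
        ext n
        exact smul_comm ((c : ℂ) ^ n) a (x n) }
    1 (by
      intro η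
      refine lp.norm_le_of_tsum_le (by norm_num) (by positivity) ?_
      have h := (lp.hasSum_norm (p := 2) (by norm_num) η).tsum_eq
      simpa [norm_smul, Circle.norm_coe] using h.le)

/-- For a word `I = i₁ ⋯ i_k`, the vector `e_I = e_{i₁} ⊗ ⋯ ⊗ e_{i_k}`; it is the vacuum vector
for the empty word. -/
def wordVec {Θ : Type*} (e : Θ → H) : List Θ → Fock H
  | [] => Fock.vacuum H
  | i :: I => creation (e i) (wordVec e I)

theorem phase_vacuum (c : Circle) : phase c (Fock.vacuum H) = Fock.vacuum H := by
  ext n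
  change (c : ℂ) ^ n • (Fock.vacuum H) n = (Fock.vacuum H) n
  cases n with
  | zero => simp
  | succ n =>
    have h : (Fock.vacuum H) (n + 1) = 0 := lp.single_apply_ne 2 0 _ (Nat.succ_ne_zero n)
    rw [h, smul_zero]

theorem phase_creation (c : Circle) (ξ : H) (η : Fock H) :
    phase c (creation ξ η) = (c : ℂ) • creation ξ (phase c η) := by
  ext n
  cases n with
  | zero =>
    change (c : ℂ) ^ 0 • (0 : (tensorPow H 0).carrier) = (c : ℂ) • (0 : (tensorPow H 0).carrier)
    simp
  | succ n =>
    change (c : ℂ) ^ (n + 1) • tensorLeft ξ n (η n) =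
      (c : ℂ) • tensorLeft ξ n ((c : ℂ) ^ n • η n)
    rw [map_smul, smul_smul, pow_succ']

/-- `x_c` is the operator with `e_I ↦ c ^ |I| e_I`. -/
theorem phase_wordVec {Θ : Type*} (e : Θ → H) (c : Circle) (I : List Θ) :
    phase c (wordVec e I) = (c : ℂ) ^ I.length • wordVec e I := by
  induction I with
  | nil => simpa [wordVec] using phase_vacuum c
  | cons i I ih =>
    rw [wordVec, phase_creation, ih, map_smul, smul_smul, List.length_cons, pow_succ']

/-- The map `P_ω(x) = ∑ ω_i l_i^* x l_i` on `B(F(H))`; for summable nonnegative weights the series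
converges absolutely in norm. -/
def fockMap {Θ : Type*} (e : HilbertBasis Θ ℂ H) (ω : Θ → ℝ) (x : Fock H →L[ℂ] Fock H) :
    Fock H →L[ℂ] Fock H :=
  ∑' i, (ω i : ℂ) • (star (creation (e i)) * x * creation (e i))

end Fock

/-! ### Poisson boundary and peripheral Poisson boundary -/

section Boundary

variable {A : Type*} [AddCommMonoid A] [Module ℂ A]

/-- The Poisson boundary `F(τ) = {x | τ x = x}`. -/
def poissonBoundary {A : Type*} (τ : A → A) : Set A := {x | τ x = x}

/-- The eigenspace `E_c(τ) = {x | τ x = c x}` for `c` in the unit circle. -/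
def peripheralEigenspace (τ : A → A) (c : Circle) : Set A := {x | τ x = (c : ℂ) • x}

/-- The peripheral Poisson boundary `P(τ)`: the norm closure of the linear span of all
eigenvectors for eigenvalues in the unit circle. -/
def peripheralBoundary [TopologicalSpace A] [ContinuousAdd A] [ContinuousConstSMul ℂ A]
    (τ : A → A) : Submodule ℂ A :=
  (Submodule.span ℂ (⋃ c : Circle, peripheralEigenspace τ c)).topologicalClosure

end Boundary

/-- Convergence of a sequence of operators in the strong operator topology. -/
def TendstoSOT {E : Type*} [NormedAddCommGroup E] [NormedSpace ℂ E]
    (x : ℕ → (E →L[ℂ] E)) (y : E →L[ℂ] E) : Prop :=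
  ∀ v, Tendsto (fun n => x n v) atTop (𝓝 (y v))

/-! ### Minimal dilation and the product on the peripheral Poisson boundary -/

section Dilation

variable {L : Type u} [NormedAddCommGroup L] [InnerProductSpace ℂ L] [CompleteSpace L]
  {K : Type v} [NormedAddCommGroup K] [InnerProductSpace ℂ K] [CompleteSpace K]

/-- For an isometric inclusion `V` of `L` into `K`, the operator on `K` which is `a` on `L` and
vanishes on the orthogonal complement of `L`. -/
def cornerEmbed (V : L →ₗᵢ[ℂ] K) (a : L →L[ℂ] L) : K →L[ℂ] K :=
  V.toContinuousLinearMap ∘L a ∘L V.toContinuousLinearMap.adjoint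

/-- The compression of an operator on `K` to the subspace `L`. -/
def cornerCompress (V : L →ₗᵢ[ℂ] K) (z : K →L[ℂ] K) : L →L[ℂ] L :=
  V.toContinuousLinearMap.adjoint ∘L z ∘L V.toContinuousLinearMap

/-- Normality of a unital `*`-endomorphism: it preserves suprema of increasing nets. -/
def IsNormalEndo (B : VonNeumannAlgebra K)
    (θ : B.toStarSubalgebra →⋆ₐ[ℂ] B.toStarSubalgebra) : Prop :=
  ∀ (S : Set B.toStarSubalgebra) (s : B.toStarSubalgebra), S.Nonempty →
    DirectedOn (fun a b : B.toStarSubalgebra => (a : K →L[ℂ] K) ≤ (b : K →L[ℂ] K)) S →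
    IsLUB ((fun a : B.toStarSubalgebra => (a : K →L[ℂ] K)) '' S) s →
    IsLUB ((fun a : B.toStarSubalgebra => (θ a : K →L[ℂ] K)) '' S) (θ s)

variable (L) in
/-- A minimal dilation `(K, B, θ)` of a map `τ : B(L) → B(L)`: a Hilbert space `K` containing `L`
(through `V`), a von Neumann algebra `B` on `K` whose corner at `L` is `B(L)`, and a normal unital
`*`-endomorphism `θ` of `B` with `τ^n(a) = p θ^n(a) p`, such that `K` is the closed linear span of
the vectors `θ^n(a_n) ⋯ θ(a_1) a_0 h` and `B` is generated by the operators `θ^n(a)`. -/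
structure MinimalDilation (τ : (L →L[ℂ] L) → (L →L[ℂ] L)) : Type (max u (v + 1)) where
  K : Type v
  [normedAddCommGroup : NormedAddCommGroup K]
  [innerProductSpace : InnerProductSpace ℂ K]
  [completeSpace : CompleteSpace K]
  V : L →ₗᵢ[ℂ] K
  B : VonNeumannAlgebra K
  corner_mem : ∀ a, cornerEmbed V a ∈ B.toStarSubalgebra
  θ : B.toStarSubalgebra →⋆ₐ[ℂ] B.toStarSubalgebra
  normal : IsNormalEndo B θ
  dilates : ∀ (n : ℕ) (a : L →L[ℂ] L),
    cornerCompress V (θ^[n] ⟨cornerEmbed V a, corner_mem a⟩ : B.toStarSubalgebra) = τ^[n] a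
  span_dense : (Submodule.span ℂ {k : K | ∃ (n : ℕ) (a : ℕ → (L →L[ℂ] L)) (h : L),
    k = Nat.rec (motive := fun _ => K) (cornerEmbed V (a 0) (V h))
      (fun m w => (θ^[m + 1] ⟨cornerEmbed V (a (m + 1)), corner_mem (a (m + 1))⟩ :
        B.toStarSubalgebra).1 w) n}).topologicalClosure = ⊤
  generates : ∀ N : VonNeumannAlgebra K,
    (∀ (n : ℕ) (a : L →L[ℂ] L),
      (θ^[n] ⟨cornerEmbed V a, corner_mem a⟩ : B.toStarSubalgebra).1 ∈ N) →
    ∀ b ∈ B, b ∈ N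

namespace MinimalDilation

variable {τ : (L →L[ℂ] L) → (L →L[ℂ] L)} (D : MinimalDilation.{u, v} L τ)

attribute [instance] MinimalDilation.normedAddCommGroup MinimalDilation.innerProductSpace
  MinimalDilation.completeSpace

/-- The peripheral Poisson boundary `P(θ)` of the dilation. -/
def boundary : Submodule ℂ D.B.toStarSubalgebra := peripheralBoundary D.θ

/-- The compression map `T`, to be considered on `P(θ)`. -/
def T (z : D.B.toStarSubalgebra) : L →L[ℂ] L := cornerCompress D.V z

/-- The product `x ∘ y = T (T⁻¹ x T⁻¹ y)` on `P(τ)`, where `T⁻¹` takes its values in `P(θ)`. -/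
def prod (x y : L →L[ℂ] L) : L →L[ℂ] L :=
  D.T (Function.invFunOn D.T D.boundary x * Function.invFunOn D.T D.boundary y)

end MinimalDilation

/-- `P` is a unital C*-algebra for the product `m` and the linear structure, the unit, the
adjoint and the operator norm of `B(L)`. -/
structure IsUnitalCStarAlgebra (P : Submodule ℂ (L →L[ℂ] L))
    (m : (L →L[ℂ] L) → (L →L[ℂ] L) → (L →L[ℂ] L)) : Prop where
  isClosed : IsClosed (P : Set (L →L[ℂ] L))
  one_mem : 1 ∈ P
  star_mem : ∀ x ∈ P, star x ∈ P
  mul_mem : ∀ x ∈ P, ∀ y ∈ P, m x y ∈ P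
  one_mul : ∀ x ∈ P, m 1 x = x
  mul_one : ∀ x ∈ P, m x 1 = x
  add_mul : ∀ x ∈ P, ∀ y ∈ P, ∀ z ∈ P, m (x + y) z = m x z + m y z
  mul_add : ∀ x ∈ P, ∀ y ∈ P, ∀ z ∈ P, m x (y + z) = m x y + m x z
  smul_mul : ∀ c : ℂ, ∀ x ∈ P, ∀ y ∈ P, m (c • x) y = c • m x y
  mul_smul : ∀ c : ℂ, ∀ x ∈ P, ∀ y ∈ P, m x (c • y) = c • m x y
  mul_assoc : ∀ x ∈ P, ∀ y ∈ P, ∀ z ∈ P, m (m x y) z = m x (m y z)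
  star_mul : ∀ x ∈ P, ∀ y ∈ P, star (m x y) = m (star y) (star x)
  norm_mul_le : ∀ x ∈ P, ∀ y ∈ P, ‖m x y‖ ≤ ‖x‖ * ‖y‖
  norm_star_mul_self : ∀ x ∈ P, ‖m (star x) x‖ = ‖x‖ * ‖x‖

/-- `F` is a unital C*-subalgebra of `P` with the product `m`. -/
structure IsUnitalCStarSubalgebra (F : Set (L →L[ℂ] L)) (P : Submodule ℂ (L →L[ℂ] L))
    (m : (L →L[ℂ] L) → (L →L[ℂ] L) → (L →L[ℂ] L)) : Prop where
  subset : F ⊆ P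
  isClosed : IsClosed F
  one_mem : 1 ∈ F
  add_mem : ∀ x ∈ F, ∀ y ∈ F, x + y ∈ F
  smul_mem : ∀ c : ℂ, ∀ x ∈ F, c • x ∈ F
  star_mem : ∀ x ∈ F, star x ∈ F
  mul_mem : ∀ x ∈ F, ∀ y ∈ F, m x y ∈ F

end Dilation

end

/-! The eigenvalue identity comes from commuting a phase past a creation operator: `phase_creation`
reads `x_c l_i = c l_i x_c`, and `l_i` is an isometry, so each `l_i^* x_c l_i` equals `c x_c`, and
the weights sum to `1`. Since `x_c x_d = x_{cd}` is again an eigenvector, the rotated iterates in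
(ii) are constant.

The rest holds for the minimal dilation of any unital `τ`. Unitality makes the projections `θ^n(p)`
fix `L` and increase with `n`; minimality makes them converge strongly to `1` (`tendstoSOT_proj`).
Two arguments use this. On the span of the eigenvectors of `θ`, some ultrafilter sends every `c^n`
to `1` simultaneously, so `z` is the limit of `θ^n(z)`, hence the strong limit of `θ^n(p) θ^n(z)
θ^n(p) = θ^n(pzp)`; this gives `‖z‖ ≤ ‖pzp‖` (`norm_T_eq`). Conversely, an eigenvector `x` of `τ`
lifts to the strong limit of `c^{-n} θ^n(x)`, whose compressions by `θ^n(p)` are consistent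
(`exists_lift`). Thus compression is an isometric bijection `P(θ) → P(τ)`, and the C*-structure is
carried across.

Multiplying two lifting sequences and compressing shows that `x ∘ y` is the strong limit of
`(cd)^{-n} τ^n(xy)` (`tendstoSOT_prod`), which identifies the products of phases and of fixed
points. For fixed points the limit is also obtained without a dilation, from Kadison's inequality,
monotone convergence and polarization (`exists_tendstoSOT_iterate_mul`). -/

noncomputable section

/-! ### Strong convergence of bounded sequences of operators -/

section StrongConvergence

variable {E : Type*} [NormedAddCommGroup E] [InnerProductSpace ℂ E]

theorem TendstoSOT.unique {x : ℕ → (E →L[ℂ] E)} {y z : E →L[ℂ] E} (hy : TendstoSOT x y)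
    (hz : TendstoSOT x z) : y = z :=
  ContinuousLinearMap.ext fun v => tendsto_nhds_unique (hy v) (hz v)

theorem TendstoSOT.add {x y : ℕ → (E →L[ℂ] E)} {a b : E →L[ℂ] E} (hx : TendstoSOT x a)
    (hy : TendstoSOT y b) : TendstoSOT (fun n => x n + y n) (a + b) :=
  fun v => (hx v).add (hy v)

theorem TendstoSOT.const_smul {x : ℕ → (E →L[ℂ] E)} {a : E →L[ℂ] E} (c : ℂ)
    (hx : TendstoSOT x a) : TendstoSOT (fun n => c • x n) (c • a) :=
  fun v => (hx v).const_smul c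

/-- A pointwise limit of bounded operators, along with pointwise convergent vectors. -/
theorem tendsto_apply_of_bounded {ι : Type*} {l : Filter ι} {x : ι → (E →L[ℂ] E)}
    {C : ℝ} (hC : ∀ n, ‖x n‖ ≤ C) {v : ι → E} {w a : E} (hx : Tendsto (fun n => x n w) l (𝓝 a))
    (hv : Tendsto v l (𝓝 w)) : Tendsto (fun n => x n (v n)) l (𝓝 a) := by
  have h1 : Tendsto (fun n => x n (v n - w)) l (𝓝 0) := by
    have h2 : Tendsto (fun n => C * ‖v n - w‖) l (𝓝 0) := by
      simpa using ((hv.sub_const w).norm).const_mul C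
    refine squeeze_zero_norm (fun n => ?_) h2
    exact (x n).le_of_opNorm_le (hC n) _
  simpa using h1.add hx

theorem TendstoSOT.mul {x y : ℕ → (E →L[ℂ] E)} {a b : E →L[ℂ] E} {C : ℝ}
    (hC : ∀ n, ‖x n‖ ≤ C) (hx : TendstoSOT x a) (hy : TendstoSOT y b) :
    TendstoSOT (fun n => x n * y n) (a * b) :=
  fun v => tendsto_apply_of_bounded hC (hx (b v)) (hy v)

/-- The vectors on which a bounded sequence of operators is Cauchy form a closed set. -/
theorem cauchySeq_apply_of_dense {x : ℕ → (E →L[ℂ] E)} {C : ℝ} (hC : ∀ n, ‖x n‖ ≤ C)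
    {s : Set E} (hs : Dense s) (h : ∀ v ∈ s, CauchySeq fun n => x n v) (v : E) :
    CauchySeq fun n => x n v := by
  have hC0 : 0 ≤ C := (norm_nonneg _).trans (hC 0)
  rw [Metric.cauchySeq_iff']
  intro ε hε
  -- `C + 1` rather than `C` keeps the denominator positive when `C = 0`.
  obtain ⟨w, hw, hd⟩ := Metric.dense_iff.1 hs v (ε / (3 * (C + 1))) (by positivity)
  obtain ⟨N, hN⟩ := Metric.cauchySeq_iff'.1 (h _ hd) (ε / 3) (by positivity)
  refine ⟨N, fun n hn => ?_⟩
  have hb : ∀ n, ‖x n (v - w)‖ < ε / 3 := by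
    intro n
    have h1 : ‖v - w‖ < ε / (3 * (C + 1)) := by
      rw [← dist_eq_norm, dist_comm]; exact hw
    calc ‖x n (v - w)‖ ≤ C * ‖v - w‖ := (x n).le_of_opNorm_le (hC n) _
      _ ≤ (C + 1) * ‖v - w‖ := by gcongr; linarith
      _ < (C + 1) * (ε / (3 * (C + 1))) := by gcongr
      _ = ε / 3 := by field_simp
  have h3 := hN n hn
  rw [dist_eq_norm] at h3 ⊢
  have h4 : x n v - x N v = x n (v - w) + (x n w - x N w) - x N (v - w) := by
    simp only [map_sub]; abel
  rw [h4]
  calc _ ≤ ‖x n (v - w)‖ + ‖x n w - x N w‖ + ‖x N (v - w)‖ :=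
        (norm_sub_le _ _).trans (by gcongr; exact norm_add_le _ _)
    _ < ε / 3 + ε / 3 + ε / 3 := by gcongr <;> exact hb _
    _ = ε := by ring

variable [CompleteSpace E]

theorem exists_tendstoSOT_of_cauchySeq {x : ℕ → (E →L[ℂ] E)}
    (h : ∀ v, CauchySeq fun n => x n v) : ∃ z, TendstoSOT x z := by
  choose f hf using fun v => cauchySeq_tendsto_of_complete (h v)
  exact ⟨continuousLinearMapOfTendsto (σ₁₂ := RingHom.id ℂ) x (tendsto_pi_nhds.2 hf), hf⟩

/-- With `a = s^* s` both sides are controlled by `‖s v‖`. The bound upgrades convergence of the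
quadratic forms of a monotone sequence to strong convergence. -/
theorem norm_apply_sq_le_of_nonneg {a : E →L[ℂ] E} (ha : 0 ≤ a) (v : E) :
    ‖a v‖ ^ 2 ≤ ‖a‖ * (inner ℂ v (a v)).re := by
  obtain ⟨s, rfl⟩ := CStarAlgebra.nonneg_iff_eq_star_mul_self.1 ha
  have h1 : (inner ℂ v ((star s * s) v)).re = ‖s v‖ ^ 2 := by
    rw [mul_apply_eq_comp, ContinuousLinearMap.star_eq_adjoint,
      ContinuousLinearMap.adjoint_inner_right]
    exact inner_self_eq_norm_sq (𝕜 := ℂ) (s v)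
  rw [h1, CStarRing.norm_star_mul_self, mul_apply_eq_comp]
  calc _ ≤ (‖s‖ * ‖s v‖) ^ 2 := by
        gcongr
        exact (star s).le_of_opNorm_le (norm_star s).le _
    _ = _ := by ring

/-- A bounded increasing sequence of operators converges strongly. -/
theorem exists_tendstoSOT_of_monotone {x : ℕ → (E →L[ℂ] E)} (hx : Monotone x) {C : ℝ}
    (hC : ∀ n, ‖x n‖ ≤ C) : ∃ z, TendstoSOT x z := by
  refine exists_tendstoSOT_of_cauchySeq fun v => ?_
  have hmono : Monotone fun n => (inner ℂ v (x n v)).re := by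
    intro n m hnm
    have h := ((ContinuousLinearMap.nonneg_iff_isPositive _).1
      (sub_nonneg.2 (hx hnm))).re_inner_nonneg_right v
    simpa [inner_sub_right] using h
  have hbdd : BddAbove (Set.range fun n => (inner ℂ v (x n v)).re) := by
    refine ⟨‖v‖ * (C * ‖v‖), ?_⟩
    rintro _ ⟨n, rfl⟩
    refine (Complex.re_le_norm _).trans ((norm_inner_le_norm _ _).trans ?_)
    gcongr
    exact (x n).le_of_opNorm_le (hC n) _
  have hcau := (tendsto_atTop_ciSup hmono hbdd).cauchySeq
  have hC0 : 0 ≤ C := (norm_nonneg _).trans (hC 0)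
  rw [Metric.cauchySeq_iff'] at hcau ⊢
  intro ε hε
  obtain ⟨N, hN⟩ := hcau (ε ^ 2 / (2 * C + 1)) (by positivity)
  refine ⟨N, fun n hn => ?_⟩
  have h1 := hN n hn
  have h2 := norm_apply_sq_le_of_nonneg (sub_nonneg.2 (hx hn)) v
  rw [Real.dist_eq, abs_of_nonneg (sub_nonneg.2 (hmono hn))] at h1
  rw [dist_eq_norm]
  have h3 : ‖x n - x N‖ ≤ 2 * C := (norm_sub_le _ _).trans (by linarith [hC n, hC N])
  simp only [sub_apply, inner_sub_right, Complex.sub_re] at h2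
  have h4 : ‖x n v - x N v‖ ^ 2 < ε ^ 2 := by
    calc _ ≤ _ := h2
      _ ≤ (2 * C + 1) * ((inner ℂ v (x n v)).re - (inner ℂ v (x N v)).re) := by
        gcongr
        · exact sub_nonneg.2 (hmono hn)
        · linarith
      _ < (2 * C + 1) * (ε ^ 2 / (2 * C + 1)) := by gcongr
      _ = ε ^ 2 := by field_simp
  exact lt_of_pow_lt_pow_left₀ 2 hε.le h4

/-- A bounded sequence of operators with `y n = q n * y m * q n` for `n ≤ m`, where the `q n` are
projections that converge strongly to `1`, converges strongly. -/
theorem exists_tendstoSOT_of_compress {q y : ℕ → (E →L[ℂ] E)} (hq : ∀ n, star (q n) = q n)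
    (hqq : ∀ n, q n * q n = q n) (hmono : ∀ n m, n ≤ m → q m * q n = q n)
    (hq1 : TendstoSOT q 1) {C : ℝ} (hC : ∀ n, ‖y n‖ ≤ C)
    (hy : ∀ n m, n ≤ m → q n * y m * q n = y n) : ∃ z, TendstoSOT y z := by
  refine exists_tendstoSOT_of_cauchySeq (cauchySeq_apply_of_dense hC
    (s := ⋃ N, Set.range (q N)) ?_ ?_)
  · intro v
    refine mem_closure_of_tendsto (hq1 v) (Eventually.of_forall fun n => ?_)
    exact Set.mem_iUnion.2 ⟨n, v, rfl⟩
  · intro v hv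
    obtain ⟨N, w, rfl⟩ := Set.mem_iUnion.1 hv
    set v := q N w with hv
    have key : ∀ n m, N ≤ n → n ≤ m → y n v = q n (y m v) := by
      intro n m hn hm
      have h1 : q n v = v := by
        rw [hv, ← mul_apply_eq_comp, hmono N n hn]
      rw [← hy n m hm, mul_apply_eq_comp, mul_apply_eq_comp, h1]
    -- By `key`, `y n v` is the projection of `y m v` onto the range of `q n`, hence orthogonal to
    -- the difference. The squared norms therefore increase, and their increments are the squared
    -- distances.
    have hpyth : ∀ n m, N ≤ n → n ≤ m → ‖y m v‖ ^ 2 - ‖y n v‖ ^ 2 = ‖y m v - y n v‖ ^ 2 := by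
      intro n m hn hm
      have h1 : inner ℂ (y m v - y n v) (y n v) = 0 := by
        rw [key n m hn hm]
        nth_rewrite 2 [← hq n]
        rw [ContinuousLinearMap.star_eq_adjoint, ContinuousLinearMap.adjoint_inner_right, map_sub,
          ← mul_apply_eq_comp (q n) (q n), hqq, sub_self, inner_zero_left]
      have h2 := norm_add_sq_eq_norm_sq_add_norm_sq_of_inner_eq_zero (𝕜 := ℂ) _ _ h1
      rw [sub_add_cancel] at h2
      nlinarith
    have hmono' : Monotone fun n => ‖y (N + n) v‖ ^ 2 := by
      intro n m hnm
      have := hpyth (N + n) (N + m) (by omega) (by omega)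
      have := sq_nonneg ‖y (N + m) v - y (N + n) v‖
      simp only
      linarith
    have hbdd : BddAbove (Set.range fun n => ‖y (N + n) v‖ ^ 2) := by
      refine ⟨(C * ‖v‖) ^ 2, ?_⟩
      rintro _ ⟨n, rfl⟩
      simp only
      gcongr
      exact (y _).le_of_opNorm_le (hC _) _
    have hcau := (tendsto_atTop_ciSup hmono' hbdd).cauchySeq
    rw [Metric.cauchySeq_iff'] at hcau ⊢
    intro ε hε
    obtain ⟨M, hM⟩ := hcau (ε ^ 2) (by positivity)
    refine ⟨N + M, fun n hn => ?_⟩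
    have h1 := hM (n - N) (by omega)
    rw [show N + (n - N) = n by omega, Real.dist_eq, hpyth _ _ (by omega) hn,
      abs_of_nonneg (sq_nonneg _)] at h1
    rw [dist_eq_norm]
    exact lt_of_pow_lt_pow_left₀ 2 hε.le h1

/-- By the bicommutant theorem it suffices to commute with the commutant, and this passes to
pointwise limits. -/
theorem VonNeumannAlgebra.mem_of_tendsto (B : VonNeumannAlgebra E) {ι : Type*} {l : Filter ι}
    [l.NeBot] {x : ι → (E →L[ℂ] E)} {z : E →L[ℂ] E} (hx : ∀ n, x n ∈ B)
    (h : ∀ v, Tendsto (fun n => x n v) l (𝓝 (z v))) : z ∈ B := by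
  rw [← B.commutant_commutant, VonNeumannAlgebra.mem_commutant_iff]
  intro g hg
  ext v
  refine tendsto_nhds_unique ((g.continuous.tendsto _).comp (h v)) ?_
  refine (h (g v)).congr fun n => ?_
  have := congrArg (fun f : E →L[ℂ] E => f v)
    (VonNeumannAlgebra.mem_commutant_iff.1 hg (x n) (hx n))
  exact this

theorem VonNeumannAlgebra.isClosed (B : VonNeumannAlgebra E) :
    IsClosed (B.toStarSubalgebra : Set (E →L[ℂ] E)) := by
  rw [VonNeumannAlgebra.coe_toStarSubalgebra, ← B.centralizer_centralizer]
  exact Set.isClosed_centralizer _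

end StrongConvergence

/-! ### Embedding into and compression to a corner -/

section Corner

variable {L : Type u} [NormedAddCommGroup L] [InnerProductSpace ℂ L] [CompleteSpace L]
  {K : Type v} [NormedAddCommGroup K] [InnerProductSpace ℂ K] [CompleteSpace K]

theorem adjoint_apply_isometry (V : L →ₗᵢ[ℂ] K) (h : L) :
    V.toContinuousLinearMap.adjoint (V h) = h := by
  have h1 := (ContinuousLinearMap.norm_map_iff_adjoint_comp_self V.toContinuousLinearMap).1
    V.norm_map
  exact congrArg (fun f : L →L[ℂ] L => f h) h1

theorem cornerEmbed_apply (V : L →ₗᵢ[ℂ] K) (a : L →L[ℂ] L) (k : K) :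
    cornerEmbed V a k = V (a (V.toContinuousLinearMap.adjoint k)) := rfl

theorem cornerCompress_apply (V : L →ₗᵢ[ℂ] K) (z : K →L[ℂ] K) (h : L) :
    cornerCompress V z h = V.toContinuousLinearMap.adjoint (z (V h)) := rfl

theorem cornerEmbed_mul (V : L →ₗᵢ[ℂ] K) (a b : L →L[ℂ] L) :
    cornerEmbed V (a * b) = cornerEmbed V a * cornerEmbed V b := by
  ext k
  simp [cornerEmbed_apply, adjoint_apply_isometry]

theorem star_cornerEmbed (V : L →ₗᵢ[ℂ] K) (a : L →L[ℂ] L) :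
    star (cornerEmbed V a) = cornerEmbed V (star a) := by
  simp [cornerEmbed, ContinuousLinearMap.star_eq_adjoint, ContinuousLinearMap.adjoint_comp,
    ContinuousLinearMap.comp_assoc]

theorem star_cornerCompress (V : L →ₗᵢ[ℂ] K) (z : K →L[ℂ] K) :
    star (cornerCompress V z) = cornerCompress V (star z) := by
  simp [cornerCompress, ContinuousLinearMap.star_eq_adjoint, ContinuousLinearMap.adjoint_comp,
    ContinuousLinearMap.comp_assoc]

theorem cornerEmbed_cornerCompress (V : L →ₗᵢ[ℂ] K) (z : K →L[ℂ] K) :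
    cornerEmbed V (cornerCompress V z) = cornerEmbed V 1 * z * cornerEmbed V 1 := by
  ext k
  simp [cornerEmbed_apply, cornerCompress_apply]

theorem norm_cornerCompress_le (V : L →ₗᵢ[ℂ] K) (z : K →L[ℂ] K) :
    ‖cornerCompress V z‖ ≤ ‖z‖ := by
  have h1 : ‖V.toContinuousLinearMap‖ ≤ 1 := V.norm_toContinuousLinearMap_le
  have h2 : ‖V.toContinuousLinearMap.adjoint‖ ≤ 1 := by
    rwa [LinearIsometryEquiv.norm_map]
  calc ‖cornerCompress V z‖ ≤ ‖V.toContinuousLinearMap.adjoint‖ *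
        (‖z‖ * ‖V.toContinuousLinearMap‖) :=
        (ContinuousLinearMap.opNorm_comp_le _ _).trans
          (by gcongr; exact ContinuousLinearMap.opNorm_comp_le _ _)
    _ ≤ 1 * (‖z‖ * 1) := by gcongr
    _ = ‖z‖ := by ring

theorem norm_cornerEmbed_le (V : L →ₗᵢ[ℂ] K) (a : L →L[ℂ] L) : ‖cornerEmbed V a‖ ≤ ‖a‖ := by
  have h1 : ‖V.toContinuousLinearMap‖ ≤ 1 := V.norm_toContinuousLinearMap_le
  have h2 : ‖V.toContinuousLinearMap.adjoint‖ ≤ 1 := by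
    rwa [LinearIsometryEquiv.norm_map]
  calc ‖cornerEmbed V a‖ ≤ ‖V.toContinuousLinearMap‖ *
        (‖a‖ * ‖V.toContinuousLinearMap.adjoint‖) :=
        (ContinuousLinearMap.opNorm_comp_le _ _).trans
          (by gcongr; exact ContinuousLinearMap.opNorm_comp_le _ _)
    _ ≤ 1 * (‖a‖ * 1) := by gcongr
    _ = ‖a‖ := by ring

/-- Compression to the corner as a linear map. -/
def cornerCompressₗ (V : L →ₗᵢ[ℂ] K) : (K →L[ℂ] K) →ₗ[ℂ] (L →L[ℂ] L) where
  toFun := cornerCompress V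
  map_add' x y := by ext; simp [cornerCompress_apply]
  map_smul' c x := by ext; simp [cornerCompress_apply]

theorem TendstoSOT.cornerCompress (V : L →ₗᵢ[ℂ] K) {x : ℕ → (K →L[ℂ] K)} {z : K →L[ℂ] K}
    (h : TendstoSOT x z) :
    TendstoSOT (fun n => cornerCompress V (x n)) (cornerCompress V z) :=
  fun v => ((V.toContinuousLinearMap.adjoint).continuous.tendsto _).comp (h (V v))

end Corner

/-! ### Peripheral eigenvectors of a `*`-endomorphism -/

section Peripheral

variable {A : Type*} [NormedRing A] [StarRing A] [NormedAlgebra ℂ A]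

theorem smul_iterate_of_mem_peripheralEigenspace {A : Type*} [AddCommMonoid A] [Module ℂ A]
    {τ : A → A} (hτ : ∀ (c : ℂ) (x : A), τ (c • x) = c • τ x) {c : Circle} {x : A}
    (hx : x ∈ peripheralEigenspace τ c) (n : ℕ) : τ^[n] x = (c : ℂ) ^ n • x := by
  induction n with
  | zero => simp
  | succ n ih =>
    rw [Function.iterate_succ_apply', ih, hτ, show τ x = (c : ℂ) • x from hx, smul_smul, pow_succ]

theorem peripheralEigenspace_subset_boundary {A : Type*} [AddCommMonoid A] [Module ℂ A]
    [TopologicalSpace A] [ContinuousAdd A] [ContinuousConstSMul ℂ A] (τ : A → A) (c : Circle) :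
    peripheralEigenspace τ c ⊆ peripheralBoundary τ :=
  (Set.subset_iUnion _ c).trans (Submodule.subset_span.trans
    (Submodule.le_topologicalClosure _))

theorem peripheralEigenspace_one {A : Type*} [AddCommMonoid A] [Module ℂ A] (τ : A → A) :
    peripheralEigenspace τ 1 = poissonBoundary τ := by
  ext x; simp [peripheralEigenspace, poissonBoundary]

variable (θ : A →⋆ₐ[ℂ] A)

theorem mul_mem_peripheralEigenspace {c d : Circle} {x y : A}
    (hx : x ∈ peripheralEigenspace θ c) (hy : y ∈ peripheralEigenspace θ d) :
    x * y ∈ peripheralEigenspace θ (c * d) := by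
  change θ (x * y) = _
  rw [map_mul, show θ x = _ from hx, show θ y = _ from hy, smul_mul_smul_comm, Circle.coe_mul]

theorem star_mem_peripheralEigenspace [StarModule ℂ A] {c : Circle} {x : A}
    (hx : x ∈ peripheralEigenspace θ c) : star x ∈ peripheralEigenspace θ c⁻¹ := by
  change θ (star x) = _
  rw [map_star, show θ x = _ from hx, star_smul, Circle.coe_inv_eq_conj, starRingEnd_apply]

theorem one_mem_peripheralBoundary : (1 : A) ∈ peripheralBoundary θ := by
  refine peripheralEigenspace_subset_boundary θ 1 ?_
  change θ 1 = _
  simp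

/-- Eigenvalues multiply because `θ` does; bilinearity extends this to the span and continuity to
its closure. -/
theorem mul_mem_peripheralBoundary {x y : A} (hx : x ∈ peripheralBoundary θ)
    (hy : y ∈ peripheralBoundary θ) : x * y ∈ peripheralBoundary θ := by
  refine map_mem_closure₂ continuous_mul hx hy fun a ha b hb => ?_
  rw [SetLike.mem_coe] at ha hb ⊢
  induction ha, hb using Submodule.span_induction₂ with
  | mem_mem a b ha hb =>
    obtain ⟨c, ha⟩ := Set.mem_iUnion.1 ha
    obtain ⟨d, hb⟩ := Set.mem_iUnion.1 hb
    exact Submodule.subset_span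
      (Set.mem_iUnion.2 ⟨c * d, mul_mem_peripheralEigenspace θ ha hb⟩)
  | zero_left => simp
  | zero_right => simp
  | add_left a b c _ _ _ h1 h2 => rw [add_mul]; exact add_mem h1 h2
  | add_right a b c _ _ _ h1 h2 => rw [mul_add]; exact add_mem h1 h2
  | smul_left r a b _ _ h => rw [smul_mul_assoc]; exact Submodule.smul_mem _ _ h
  | smul_right r a b _ _ h => rw [mul_smul_comm]; exact Submodule.smul_mem _ _ h

theorem star_mem_peripheralBoundary [StarModule ℂ A] [ContinuousStar A] {x : A} (hx : x ∈ peripheralBoundary θ) :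
    star x ∈ peripheralBoundary θ := by
  refine map_mem_closure continuous_star hx fun a ha => ?_
  rw [SetLike.mem_coe] at ha ⊢
  induction ha using Submodule.span_induction with
  | mem a ha =>
    obtain ⟨c, ha⟩ := Set.mem_iUnion.1 ha
    exact Submodule.subset_span
      (Set.mem_iUnion.2 ⟨c⁻¹, star_mem_peripheralEigenspace θ ha⟩)
  | zero => simp
  | add a b _ _ h1 h2 => rw [star_add]; exact add_mem h1 h2
  | smul r a _ h => rw [star_smul]; exact Submodule.smul_mem _ _ h

/-- Along some ultrafilter the powers of `θ` converge to the identity on the span of the peripheral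
eigenvectors. -/
theorem exists_ultrafilter_tendsto_iterate :
    ∃ l : Ultrafilter ℕ, (l : Filter ℕ) ≤ atTop ∧
      ∀ z ∈ Submodule.span ℂ (⋃ c : Circle, peripheralEigenspace θ c),
        Tendsto (fun n => θ^[n] z) l (𝓝 z) := by
  -- Recurrence is applied to the identity in the compact group of all functions `Circle → Circle`,
  -- so one ultrafilter serves every eigenvalue.
  obtain ⟨l, hl, hlim⟩ := mapClusterPt_iff_ultrafilter.1
    (mapClusterPt_one_atTop_pow (id : Circle → Circle))
  refine ⟨l, hl, fun z hz => ?_⟩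
  induction hz using Submodule.span_induction with
  | mem z hz =>
    obtain ⟨c, hz⟩ := Set.mem_iUnion.1 hz
    have h1 : Tendsto (fun n : ℕ => ((c ^ n : Circle) : ℂ)) l (𝓝 ((1 : Circle) : ℂ)) :=
      (continuous_subtype_val.tendsto _).comp (tendsto_pi_nhds.1 hlim c)
    have h2 := h1.smul_const z
    simp only [Circle.coe_pow, Circle.coe_one, one_smul] at h2
    exact h2.congr fun n =>
      (smul_iterate_of_mem_peripheralEigenspace (fun c x => map_smul θ c x) hz n).symm
  | zero => simp [iterate_map_zero]
  | add a b _ _ h1 h2 => simpa [iterate_map_add] using h1.add h2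
  | smul r a _ h =>
    refine (h.const_smul r).congr fun n => ?_
    exact ((show Function.Commute θ (r • ·) from fun x => map_smul θ r x).iterate_left n a).symm

end Peripheral

/-! ### Algebra of a minimal dilation -/

namespace MinimalDilation

variable {L : Type u} [NormedAddCommGroup L] [InnerProductSpace ℂ L] [CompleteSpace L]
variable {τ : (L →L[ℂ] L) → (L →L[ℂ] L)} (D : MinimalDilation.{u, v} L τ)

/-- The inclusion of `B(L)` in the corner of `B`. -/
def embed (a : L →L[ℂ] L) : D.B.toStarSubalgebra := ⟨cornerEmbed D.V a, D.corner_mem a⟩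

/-- The iterates of `θ` as `*`-homomorphisms. -/
def iter : ℕ → (D.B.toStarSubalgebra →⋆ₐ[ℂ] D.B.toStarSubalgebra)
  | 0 => StarAlgHom.id ℂ _
  | n + 1 => (iter n).comp D.θ

theorem coe_iter (n : ℕ) : ⇑(D.iter n) = D.θ^[n] := by
  induction n with
  | zero => rfl
  | succ n ih => rw [Function.iterate_succ, ← ih]; rfl

theorem iter_add_apply (m n : ℕ) (z : D.B.toStarSubalgebra) :
    D.iter (m + n) z = D.iter m (D.iter n z) := by
  rw [coe_iter, coe_iter, coe_iter, Function.iterate_add_apply]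

theorem isClosed_algebra : IsClosed (D.B.toStarSubalgebra : Set (D.K →L[ℂ] D.K)) :=
  D.B.isClosed

instance completeSpace_algebra : CompleteSpace D.B.toStarSubalgebra :=
  D.isClosed_algebra.completeSpace_coe

theorem norm_iter_le (n : ℕ) (z : D.B.toStarSubalgebra) : ‖D.iter n z‖ ≤ ‖z‖ := by
  have := D.isClosed_algebra
  exact NonUnitalStarAlgHom.norm_apply_le (D.iter n) z

theorem embed_mul (a b : L →L[ℂ] L) : D.embed (a * b) = D.embed a * D.embed b :=
  Subtype.ext (cornerEmbed_mul _ _ _)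

theorem star_embed (a : L →L[ℂ] L) : star (D.embed a) = D.embed (star a) :=
  Subtype.ext (star_cornerEmbed _ _)

theorem embed_T (z : D.B.toStarSubalgebra) : D.embed (D.T z) = D.embed 1 * z * D.embed 1 :=
  Subtype.ext (cornerEmbed_cornerCompress _ _)

theorem T_iter_embed (n : ℕ) (a : L →L[ℂ] L) : D.T (D.iter n (D.embed a)) = τ^[n] a := by
  rw [coe_iter]; exact D.dilates n a

theorem T_embed (a : L →L[ℂ] L) : D.T (D.embed a) = a := D.T_iter_embed 0 a

theorem norm_T_le (z : D.B.toStarSubalgebra) : ‖D.T z‖ ≤ ‖z‖ := norm_cornerCompress_le _ _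

theorem norm_embed_le (a : L →L[ℂ] L) : ‖D.embed a‖ ≤ ‖a‖ := norm_cornerEmbed_le _ _

/-- The compression as a linear map. -/
def Tₗ : D.B.toStarSubalgebra →ₗ[ℂ] (L →L[ℂ] L) :=
  (cornerCompressₗ D.V).comp D.B.toStarSubalgebra.subtype.toAlgHom.toLinearMap

theorem Tₗ_apply (z : D.B.toStarSubalgebra) : D.Tₗ z = D.T z := rfl

theorem continuous_T : Continuous D.T :=
  (AddMonoidHomClass.continuous_of_bound D.Tₗ 1 fun z => by
    rw [one_mul]; exact D.norm_T_le z :)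

theorem T_star (z : D.B.toStarSubalgebra) : D.T (star z) = star (D.T z) :=
  (star_cornerCompress _ _).symm

theorem T_one : D.T 1 = 1 := by
  ext h
  exact adjoint_apply_isometry D.V h

theorem embed_smul (c : ℂ) (a : L →L[ℂ] L) : D.embed (c • a) = c • D.embed a := by
  ext k; simp [embed, cornerEmbed_apply]

include D in
-- `τ` is given only as a function; its homogeneity is inherited from `τ(a) = p θ(a) p`.
theorem map_smul_of_dilation (c : ℂ) (a : L →L[ℂ] L) : τ (c • a) = c • τ a := by
  have h := D.T_iter_embed 1
  simp only [Function.iterate_one] at h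
  rw [← h, ← h, embed_smul, map_smul, ← Tₗ_apply, map_smul, Tₗ_apply]

/-- The projections `θ^n(p)`. -/
def proj (n : ℕ) : D.B.toStarSubalgebra := D.iter n (D.embed 1)

theorem embed_one_mul_self : D.embed 1 * D.embed 1 = D.embed 1 := by
  rw [← embed_mul, mul_one]

theorem proj_mul_self (n : ℕ) : D.proj n * D.proj n = D.proj n := by
  rw [proj, ← map_mul, embed_one_mul_self]

theorem star_proj (n : ℕ) : star (D.proj n) = D.proj n := by
  rw [proj, ← map_star, star_embed, star_one]

theorem proj_mul_iter_embed (n : ℕ) (a : L →L[ℂ] L) :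
    D.proj n * D.iter n (D.embed a) = D.iter n (D.embed a) := by
  rw [proj, ← map_mul, ← embed_mul, one_mul]

/-- This lets `τ`-side data `T z` control `θ^n(z)` on the range of `θ^n(p)`, which exhausts `K` in
the limit. -/
theorem iter_embed_T (n : ℕ) (z : D.B.toStarSubalgebra) :
    D.iter n (D.embed (D.T z)) = D.proj n * D.iter n z * D.proj n := by
  rw [embed_T, map_mul, map_mul, proj]

/-! ### Dilations of unital maps: the compression is an isometric bijection of boundaries -/

variable {D}
variable (hτ : τ 1 = 1)
include hτ

/-- The compression of the projection `θ^n(p)` to `L` is `τ^n(1) = 1`, and a projection `q` with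
`⟨qk, k⟩ = ‖k‖²` fixes `k`. -/
theorem proj_apply_V (n : ℕ) (h : L) : (D.proj n).1 (D.V h) = D.V h := by
  have h1 : D.T (D.proj n) = 1 := by
    rw [proj, T_iter_embed]
    exact Function.iterate_fixed hτ n
  have h2 : inner ℂ ((D.proj n).1 (D.V h)) (D.V h) = inner ℂ (D.V h) (D.V h) := by
    have h3 : D.V.toContinuousLinearMap.adjoint ((D.proj n).1 (D.V h)) = h :=
      congrArg (fun f : L →L[ℂ] L => f h) h1
    have h4 := ContinuousLinearMap.adjoint_inner_left D.V.toContinuousLinearMap h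
      ((D.proj n).1 (D.V h))
    rw [h3] at h4
    rw [LinearIsometry.inner_map_map]
    exact h4.symm
  have hs : ContinuousLinearMap.adjoint (D.proj n).1 = (D.proj n).1 :=
    congrArg Subtype.val (D.star_proj n)
  have hm : ∀ k, (D.proj n).1 ((D.proj n).1 k) = (D.proj n).1 k := fun k =>
    congrArg (fun f : D.B.toStarSubalgebra => f.1 k) (D.proj_mul_self n)
  have h5 : inner ℂ ((D.proj n).1 (D.V h)) ((D.proj n).1 (D.V h)) =
      inner ℂ (D.V h) (D.V h) := by
    rw [← h2]
    rw [← ContinuousLinearMap.adjoint_inner_right, hs, hm]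
    rw [← inner_conj_symm, h2, inner_conj_symm]
  have h6 : inner ℂ (D.V h) ((D.proj n).1 (D.V h)) = inner ℂ (D.V h) (D.V h) := by
    rw [← inner_conj_symm, h2, inner_conj_symm]
  rw [← sub_eq_zero, ← inner_self_eq_zero (𝕜 := ℂ), inner_sub_left, inner_sub_right,
    inner_sub_right, h5, h2, h6]
  simp

theorem proj_mul_embed_one (n : ℕ) : D.proj n * D.embed 1 = D.embed 1 := by
  ext k
  exact proj_apply_V hτ n _

theorem proj_mul_proj {n m : ℕ} (h : n ≤ m) : D.proj m * D.proj n = D.proj n := by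
  obtain ⟨k, rfl⟩ := Nat.exists_eq_add_of_le h
  rw [proj, iter_add_apply, proj, ← map_mul]
  exact congrArg _ (proj_mul_embed_one hτ k)

omit hτ in
theorem norm_proj_le (n : ℕ) : ‖(D.proj n).1‖ ≤ 1 := by
  refine (D.norm_iter_le n _).trans ((D.norm_embed_le 1).trans ?_)
  exact ContinuousLinearMap.norm_id_le

/-- Minimality of the dilation makes the projections `θ^n(p)` increase to `1`. -/
theorem tendstoSOT_proj : TendstoSOT (fun n => (D.proj n).1) 1 := by
  have hspan : ∀ v ∈ Submodule.span ℂ {k : D.K | ∃ (n : ℕ) (a : ℕ → (L →L[ℂ] L)) (h : L),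
      k = Nat.rec (motive := fun _ => D.K) (cornerEmbed D.V (a 0) (D.V h))
      (fun m w => (D.θ^[m + 1] ⟨cornerEmbed D.V (a (m + 1)), D.corner_mem (a (m + 1))⟩ :
        D.B.toStarSubalgebra).1 w) n}, Tendsto (fun n => (D.proj n).1 v) atTop (𝓝 v) := by
    intro v hv
    induction hv using Submodule.span_induction with
    | mem v hv =>
      obtain ⟨n, a, h, rfl⟩ := hv
      -- A generating vector of length `n` lies in the range of `θ^n(p)`, so every `θ^m(p)` with `m
      -- ≥ n` fixes it.
      refine tendsto_const_nhds.congr' ?_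
      filter_upwards [eventually_ge_atTop n] with m hm
      cases n with
      | zero => exact (proj_apply_V hτ m _).symm
      | succ n =>
        have h1 : D.proj m * D.iter (n + 1) (D.embed (a (n + 1))) =
            D.iter (n + 1) (D.embed (a (n + 1))) := by
          rw [← D.proj_mul_iter_embed, ← mul_assoc, proj_mul_proj hτ hm]
        rw [coe_iter] at h1
        exact (congrArg (fun f : D.B.toStarSubalgebra => f.1 _) h1).symm
    | zero => simp
    | add a b _ _ h1 h2 => simpa using h1.add h2
    | smul r a _ h => simpa using h.const_smul r
  have hdense : Dense (Submodule.span ℂ {k : D.K | ∃ (n : ℕ) (a : ℕ → (L →L[ℂ] L)) (h : L),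
      k = Nat.rec (motive := fun _ => D.K) (cornerEmbed D.V (a 0) (D.V h))
      (fun m w => (D.θ^[m + 1] ⟨cornerEmbed D.V (a (m + 1)), D.corner_mem (a (m + 1))⟩ :
        D.B.toStarSubalgebra).1 w) n} : Set D.K) :=
    Submodule.dense_iff_topologicalClosure_eq_top.2 D.span_dense
  obtain ⟨z, hz⟩ := exists_tendstoSOT_of_cauchySeq
    (cauchySeq_apply_of_dense D.norm_proj_le hdense fun v hv => (hspan v hv).cauchySeq)
  have h1 : z = 1 := by
    refine ContinuousLinearMap.ext fun v => ?_
    have := z.continuous.ext_on hdense continuous_id fun v hv =>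
      tendsto_nhds_unique (hz v) (hspan v hv)
    exact congrFun this v
  exact h1 ▸ hz

/-- `T` is isometric on the peripheral Poisson boundary of `θ`. -/
theorem norm_T_eq {z : D.B.toStarSubalgebra} (hz : z ∈ D.boundary) : ‖D.T z‖ = ‖z‖ := by
  have hclosed : IsClosed {z : D.B.toStarSubalgebra | ‖D.T z‖ = ‖z‖} :=
    isClosed_eq D.continuous_T.norm continuous_norm
  obtain ⟨l, hl, hlim⟩ := exists_ultrafilter_tendsto_iterate D.θ
  refine closure_minimal (fun z hz => le_antisymm (D.norm_T_le z) ?_) hclosed hz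
  refine ContinuousLinearMap.opNorm_le_bound _ (norm_nonneg _) fun v => ?_
  -- The operators here equal `θ^n(pzp)`, of norm at most `‖D.T z‖`, and they tend strongly to `z`
  -- along `l`.
  have h1 : Tendsto (fun n => (D.proj n).1 ((D.iter n z).1 ((D.proj n).1 v))) l
      (𝓝 (z.1 v)) := by
    have hp : ∀ v, Tendsto (fun n => (D.proj n).1 v) l (𝓝 v) := fun v =>
      (tendstoSOT_proj hτ v).mono_left hl
    refine tendsto_apply_of_bounded D.norm_proj_le (hp (z.1 v)) ?_
    have h2 : Tendsto (fun n => (D.iter n z).1 v) l (𝓝 (z.1 v)) := by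
      have h3 := hlim z hz
      simp only [← coe_iter] at h3
      exact ((ContinuousLinearMap.apply ℂ D.K v).continuous.tendsto _).comp
        ((continuous_subtype_val.tendsto _).comp h3)
    exact tendsto_apply_of_bounded (D.norm_iter_le · z) h2 (hp v)
  refine le_of_tendsto h1.norm (Eventually.of_forall fun n => ?_)
  have h3 : (D.proj n).1 ((D.iter n z).1 ((D.proj n).1 v)) =
      (D.iter n (D.embed (D.T z))).1 v := by
    rw [iter_embed_T]; rfl
  rw [h3]
  exact ContinuousLinearMap.le_of_opNorm_le _
    ((D.norm_iter_le n _).trans (D.norm_embed_le _)) v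

theorem T_injOn : Set.InjOn D.T D.boundary := by
  intro x hx y hy h
  have h1 := norm_T_eq hτ (sub_mem hx hy)
  rw [← Tₗ_apply, map_sub, Tₗ_apply, Tₗ_apply, h, sub_self, norm_zero] at h1
  exact sub_eq_zero.1 (norm_eq_zero.1 h1.symm)

/-- Since `θ(p)` fixes `L`, `pθ(z)p` is unchanged when `θ(z)` is replaced by `θ(p)θ(z)θ(p) =
θ(pzp)`. Hence compression intertwines `θ` and `τ` on all of `B`. -/
theorem T_θ (z : D.B.toStarSubalgebra) : D.T (D.θ z) = τ (D.T z) := by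
  have h1 := D.T_iter_embed 1 (D.T z)
  rw [iter_embed_T, Function.iterate_one] at h1
  rw [← h1]
  ext h
  change D.V.toContinuousLinearMap.adjoint _ = D.V.toContinuousLinearMap.adjoint
    ((D.proj 1).1 ((D.θ z).1 ((D.proj 1).1 (D.V h))))
  rw [proj_apply_V hτ]
  refine ext_inner_left ℂ fun g => ?_
  rw [ContinuousLinearMap.adjoint_inner_right, ContinuousLinearMap.adjoint_inner_right,
    ← ContinuousLinearMap.adjoint_inner_left (D.proj 1).1]
  have hs : ContinuousLinearMap.adjoint (D.proj 1).1 = (D.proj 1).1 :=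
    congrArg Subtype.val (D.star_proj 1)
  rw [hs]
  erw [proj_apply_V hτ]
  rfl

theorem T_mem_peripheralEigenspace {c : Circle} {z : D.B.toStarSubalgebra}
    (hz : z ∈ peripheralEigenspace D.θ c) : D.T z ∈ peripheralEigenspace τ c := by
  change τ (D.T z) = _
  rw [← T_θ hτ, show D.θ z = _ from hz, ← Tₗ_apply, map_smul, Tₗ_apply]

/-- Each peripheral eigenvector `x` of `τ` lifts to the eigenvector
`lim_n c⁻ⁿ θ^n(x)` of `θ`. -/
theorem exists_lift {c : Circle} {x : L →L[ℂ] L} (hx : x ∈ peripheralEigenspace τ c) :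
    ∃ z ∈ peripheralEigenspace D.θ c, D.T z = x ∧
      TendstoSOT (fun n => ((c : ℂ)⁻¹ ^ n • D.iter n (D.embed x)).1) z.1 := by
  have hc : (c : ℂ) ≠ 0 := Circle.coe_ne_zero c
  set y : ℕ → D.B.toStarSubalgebra := fun n => (c : ℂ)⁻¹ ^ n • D.iter n (D.embed x) with hy
  have hiter := smul_iterate_of_mem_peripheralEigenspace (map_smul_of_dilation D) hx
  have hbound : ∀ n, ‖(y n).1‖ ≤ ‖x‖ := by
    intro n
    change ‖y n‖ ≤ _
    rw [hy, norm_smul, norm_pow, norm_inv, Circle.norm_coe, inv_one, one_pow, one_mul]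
    exact (D.norm_iter_le n _).trans (D.norm_embed_le x)
  -- For `m = n + k`, compressing `θ^{n+k}(x)` by `θ^n(p)` gives `θ^n(τ^k(x)) = c^k θ^n(x)`.
  have hcomp : ∀ n m, n ≤ m → D.proj n * y m * D.proj n = y n := by
    intro n m h
    obtain ⟨k, rfl⟩ := Nat.exists_eq_add_of_le h
    simp only [hy]
    rw [mul_smul_comm, smul_mul_assoc, iter_add_apply, ← iter_embed_T, T_iter_embed, hiter,
      embed_smul, map_smul, smul_smul, pow_add, mul_assoc, ← mul_pow, inv_mul_cancel₀ hc,
      one_pow, mul_one]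
  obtain ⟨z, hz⟩ := exists_tendstoSOT_of_compress (q := fun n => (D.proj n).1)
    (y := fun n => (y n).1)
    (fun n => congrArg Subtype.val (D.star_proj n))
    (fun n => congrArg Subtype.val (D.proj_mul_self n))
    (fun n m h => congrArg Subtype.val (proj_mul_proj hτ h)) (tendstoSOT_proj hτ) hbound
    (fun n m h => congrArg Subtype.val (hcomp n m h))
  have hzB : z ∈ D.B.toStarSubalgebra := D.B.mem_of_tendsto (fun n => (y n).2) hz
  have hcz : ∀ n, D.proj n * ⟨z, hzB⟩ * D.proj n = y n := by
    intro n
    ext v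
    refine tendsto_nhds_unique (((D.proj n).1.continuous.tendsto _).comp
      (hz ((D.proj n).1 v))) (tendsto_const_nhds.congr' ?_)
    filter_upwards [eventually_ge_atTop n] with m hm
    exact (congrArg (fun f : D.B.toStarSubalgebra => f.1 v) (hcomp n m hm)).symm
  refine ⟨⟨z, hzB⟩, ?_, ?_, hz⟩
  · have h1 : ∀ n, D.proj (n + 1) * D.θ ⟨z, hzB⟩ * D.proj (n + 1) = (c : ℂ) • y (n + 1) := by
      intro n
      have h2 : ∀ w, D.iter (n + 1) w = D.θ (D.iter n w) := fun w => by
        rw [coe_iter, coe_iter, Function.iterate_succ_apply']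
      have h3 : D.proj (n + 1) = D.θ (D.proj n) := h2 _
      rw [h3, ← map_mul, ← map_mul, hcz]
      simp only [hy]
      rw [map_smul, h2, smul_smul, pow_succ', ← mul_assoc, mul_inv_cancel₀ hc, one_mul]
    refine Subtype.ext (ContinuousLinearMap.ext fun v => ?_)
    have h2 : Tendsto (fun n => ((D.proj (n + 1) * D.θ ⟨z, hzB⟩ * D.proj (n + 1)).1 v))
        atTop (𝓝 ((D.θ ⟨z, hzB⟩).1 v)) := by
      have hp : ∀ v, Tendsto (fun n => (D.proj (n + 1)).1 v) atTop (𝓝 v) := fun v =>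
        (tendstoSOT_proj hτ v).comp (tendsto_add_atTop_nat 1)
      exact tendsto_apply_of_bounded (fun n => D.norm_proj_le (n + 1)) (hp _)
        (((D.θ ⟨z, hzB⟩).1.continuous.tendsto _).comp (hp v))
    refine tendsto_nhds_unique h2 ?_
    simp only [h1]
    exact ((hz v).comp (tendsto_add_atTop_nat 1)).const_smul (c : ℂ)
  · have h1 : D.T (D.proj 0 * ⟨z, hzB⟩ * D.proj 0) = x := by
      rw [hcz]
      simp only [hy, pow_zero, one_smul]
      exact D.T_embed x
    rw [← h1]
    change _ = D.T (D.embed 1 * _ * D.embed 1)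
    rw [← embed_T, T_embed]

theorem T_bijOn : Set.BijOn D.T D.boundary (peripheralBoundary τ) := by
  refine ⟨?_, T_injOn hτ, ?_⟩
  · intro z hz
    refine map_mem_closure D.continuous_T hz fun w hw => ?_
    have h1 : Submodule.span ℂ (⋃ c : Circle, peripheralEigenspace D.θ c) ≤
        (Submodule.span ℂ (⋃ c : Circle, peripheralEigenspace τ c)).comap D.Tₗ := by
      refine Submodule.span_le.2 (Set.iUnion_subset fun c w hw => ?_)
      exact Submodule.subset_span
        (Set.mem_iUnion.2 ⟨c, T_mem_peripheralEigenspace hτ hw⟩)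
    exact h1 hw
  -- An isometric image of a complete space is closed, so containing the eigenvectors is enough.
  · have hcomplete : IsClosed (D.T '' D.boundary) := by
      let f : D.boundary →ₗᵢ[ℂ] (L →L[ℂ] L) :=
        ⟨D.Tₗ.comp D.boundary.subtype, fun z => norm_T_eq hτ z.2⟩
      have : CompleteSpace D.boundary :=
        (Submodule.isClosed_topologicalClosure _).completeSpace_coe
      have h1 : D.T '' D.boundary = Set.range f := by
        ext x
        constructor
        · rintro ⟨z, hz, rfl⟩; exact ⟨⟨z, hz⟩, rfl⟩
        · rintro ⟨z, rfl⟩; exact ⟨z, z.2, rfl⟩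
      rw [h1]
      exact f.isometry.isClosedEmbedding.isClosed_range
    have h2 : Submodule.span ℂ (⋃ c : Circle, peripheralEigenspace τ c) ≤
        D.boundary.map D.Tₗ := by
      refine Submodule.span_le.2 (Set.iUnion_subset fun c x hx => ?_)
      obtain ⟨z, hz, rfl, -⟩ := exists_lift (D := D) hτ hx
      exact ⟨z, peripheralEigenspace_subset_boundary _ c hz, rfl⟩
    exact closure_minimal h2 hcomplete

/-- Every algebraic and norm property of `D.prod` reduces through this to the same property in `B`.
-/
theorem prod_T {z w : D.B.toStarSubalgebra} (hz : z ∈ D.boundary) (hw : w ∈ D.boundary) :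
    D.prod (D.T z) (D.T w) = D.T (z * w) := by
  rw [prod, (T_injOn hτ).leftInvOn_invFunOn hz, (T_injOn hτ).leftInvOn_invFunOn hw]

/-- The product of peripheral eigenvectors is a strong limit of rotated iterates of `τ`. -/
theorem tendstoSOT_prod {c d : Circle} {x y : L →L[ℂ] L} (hx : x ∈ peripheralEigenspace τ c)
    (hy : y ∈ peripheralEigenspace τ d) :
    TendstoSOT (fun n => ((c : ℂ) * (d : ℂ))⁻¹ ^ n • τ^[n] (x * y)) (D.prod x y) := by
  obtain ⟨z, hz, rfl, hzl⟩ := exists_lift (D := D) hτ hx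
  obtain ⟨w, hw, rfl, hwl⟩ := exists_lift (D := D) hτ hy
  rw [prod_T hτ (peripheralEigenspace_subset_boundary _ c hz)
    (peripheralEigenspace_subset_boundary _ d hw)]
  have hbound : ∀ n, ‖((c : ℂ)⁻¹ ^ n • D.iter n (D.embed (D.T z))).1‖ ≤ ‖D.T z‖ := by
    intro n
    change ‖(c : ℂ)⁻¹ ^ n • D.iter n (D.embed (D.T z))‖ ≤ _
    rw [norm_smul, norm_pow, norm_inv, Circle.norm_coe, inv_one, one_pow, one_mul]
    exact (D.norm_iter_le n _).trans (D.norm_embed_le _)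
  have h := (TendstoSOT.mul hbound hzl hwl).cornerCompress D.V
  convert h using 2 with n
  · rw [← D.T_iter_embed, embed_mul, map_mul, ← Tₗ_apply, ← map_smul, Tₗ_apply, mul_inv, mul_pow,
      ← smul_mul_smul_comm]
    rfl
  · rfl

/-! ### C*-structures carried over by the compression -/

theorem isUnitalCStarAlgebra : IsUnitalCStarAlgebra (peripheralBoundary τ) D.prod := by
  have hb := T_bijOn (D := D) hτ
  have hs := hb.surjOn
  have hmul : ∀ {z w : D.B.toStarSubalgebra}, z ∈ D.boundary → w ∈ D.boundary →
      z * w ∈ D.boundary := fun hz hw => mul_mem_peripheralBoundary D.θ hz hw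
  have hone : (1 : D.B.toStarSubalgebra) ∈ D.boundary := one_mem_peripheralBoundary D.θ
  have hstar : ∀ {z : D.B.toStarSubalgebra}, z ∈ D.boundary → star z ∈ D.boundary :=
    fun hz => star_mem_peripheralBoundary D.θ hz
  have hTadd : ∀ z w, D.T (z + w) = D.T z + D.T w := fun z w => map_add D.Tₗ z w
  have hTsmul : ∀ (c : ℂ) z, D.T (c • z) = c • D.T z := fun c z => map_smul D.Tₗ c z
  refine
    { isClosed := Submodule.isClosed_topologicalClosure _
      one_mem := D.T_one ▸ hb.mapsTo hone
      star_mem := ?_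
      mul_mem := ?_
      one_mul := ?_
      mul_one := ?_
      add_mul := ?_
      mul_add := ?_
      smul_mul := ?_
      mul_smul := ?_
      mul_assoc := ?_
      star_mul := ?_
      norm_mul_le := ?_
      norm_star_mul_self := ?_ }
  · intro x hx₀
    obtain ⟨x, hx, rfl⟩ := hs hx₀
    rw [← T_star]; exact hb.mapsTo (hstar hx)
  · intro x hx₀ y hy₀
    obtain ⟨x, hx, rfl⟩ := hs hx₀
    obtain ⟨y, hy, rfl⟩ := hs hy₀
    rw [prod_T hτ hx hy]; exact hb.mapsTo (hmul hx hy)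
  · intro x hx₀
    obtain ⟨x, hx, rfl⟩ := hs hx₀
    rw [← D.T_one, prod_T hτ hone hx, one_mul]
  · intro x hx₀
    obtain ⟨x, hx, rfl⟩ := hs hx₀
    rw [← D.T_one, prod_T hτ hx hone, mul_one]
  · intro x hx₀ y hy₀ z hz₀
    obtain ⟨x, hx, rfl⟩ := hs hx₀
    obtain ⟨y, hy, rfl⟩ := hs hy₀
    obtain ⟨z, hz, rfl⟩ := hs hz₀
    rw [← hTadd, prod_T hτ (add_mem hx hy) hz, prod_T hτ hx hz, prod_T hτ hy hz, add_mul, hTadd]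
  · intro x hx₀ y hy₀ z hz₀
    obtain ⟨x, hx, rfl⟩ := hs hx₀
    obtain ⟨y, hy, rfl⟩ := hs hy₀
    obtain ⟨z, hz, rfl⟩ := hs hz₀
    rw [← hTadd, prod_T hτ hx (add_mem hy hz), prod_T hτ hx hz, prod_T hτ hx hy, mul_add, hTadd]
  · intro c x hx₀ y hy₀
    obtain ⟨x, hx, rfl⟩ := hs hx₀
    obtain ⟨y, hy, rfl⟩ := hs hy₀
    rw [← hTsmul, prod_T hτ (Submodule.smul_mem _ c hx) hy, prod_T hτ hx hy, smul_mul_assoc,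
      hTsmul]
  · intro c x hx₀ y hy₀
    obtain ⟨x, hx, rfl⟩ := hs hx₀
    obtain ⟨y, hy, rfl⟩ := hs hy₀
    rw [← hTsmul, prod_T hτ hx (Submodule.smul_mem _ c hy), prod_T hτ hx hy, mul_smul_comm,
      hTsmul]
  · intro x hx₀ y hy₀ z hz₀
    obtain ⟨x, hx, rfl⟩ := hs hx₀
    obtain ⟨y, hy, rfl⟩ := hs hy₀
    obtain ⟨z, hz, rfl⟩ := hs hz₀
    rw [prod_T hτ hx hy, prod_T hτ (hmul hx hy) hz, prod_T hτ hy hz, prod_T hτ hx (hmul hy hz),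
      mul_assoc]
  · intro x hx₀ y hy₀
    obtain ⟨x, hx, rfl⟩ := hs hx₀
    obtain ⟨y, hy, rfl⟩ := hs hy₀
    rw [prod_T hτ hx hy, ← T_star, ← T_star, ← T_star, prod_T hτ (hstar hy) (hstar hx), star_mul]
  · intro x hx₀ y hy₀
    obtain ⟨x, hx, rfl⟩ := hs hx₀
    obtain ⟨y, hy, rfl⟩ := hs hy₀
    rw [prod_T hτ hx hy, norm_T_eq hτ hx, norm_T_eq hτ hy, norm_T_eq hτ (hmul hx hy)]
    exact norm_mul_le _ _
  · intro x hx₀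
    obtain ⟨x, hx, rfl⟩ := hs hx₀
    rw [← T_star, prod_T hτ (hstar hx) hx, norm_T_eq hτ hx, norm_T_eq hτ (hmul (hstar hx) hx)]
    exact CStarRing.norm_star_mul_self

/-- The Poisson boundary of `τ` is the image of the fixed points of `θ`. -/
theorem exists_fixed_lift {x : L →L[ℂ] L} (hx : x ∈ poissonBoundary τ) :
    ∃ z, D.θ z = z ∧ z ∈ D.boundary ∧ D.T z = x := by
  rw [← peripheralEigenspace_one] at hx
  obtain ⟨z, hz, h, -⟩ := exists_lift (D := D) hτ hx
  refine ⟨z, ?_, peripheralEigenspace_subset_boundary _ _ hz, h⟩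
  rwa [peripheralEigenspace_one] at hz

theorem isUnitalCStarSubalgebra :
    IsUnitalCStarSubalgebra (poissonBoundary τ) (peripheralBoundary τ) D.prod := by
  have hfix : ∀ {z : D.B.toStarSubalgebra}, D.θ z = z → D.T z ∈ poissonBoundary τ := by
    intro z hz
    change τ _ = _
    rw [← T_θ hτ, hz]
  have hTadd : ∀ z w, D.T (z + w) = D.T z + D.T w := fun z w => map_add D.Tₗ z w
  have hTsmul : ∀ (c : ℂ) z, D.T (c • z) = c • D.T z := fun c z => map_smul D.Tₗ c z
  have hlin : Continuous τ := by
    have h1 : τ = fun x => D.T (D.θ (D.embed x)) := by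
      funext x; rw [T_θ hτ, T_embed]
    have h2 : Continuous D.embed := by
      let f : (L →L[ℂ] L) →+ D.B.toStarSubalgebra := AddMonoidHom.mk' D.embed fun a b => by
        ext k; simp [embed, cornerEmbed_apply]
      exact (AddMonoidHomClass.continuous_of_bound f 1 fun a => by
        rw [one_mul]; exact D.norm_embed_le a :)
    have h3 : Continuous D.θ := AddMonoidHomClass.continuous_of_bound D.θ 1 fun a => by
      rw [one_mul]; exact D.norm_iter_le 1 a
    rw [h1]
    exact D.continuous_T.comp (h3.comp h2)
  refine
    { subset := ?_
      isClosed := isClosed_eq hlin continuous_id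
      one_mem := hτ
      add_mem := ?_
      smul_mem := ?_
      star_mem := ?_
      mul_mem := ?_ }
  · rw [← peripheralEigenspace_one]
    exact peripheralEigenspace_subset_boundary _ _
  · intro x hx y hy
    obtain ⟨z, hz, -, rfl⟩ := exists_fixed_lift (D := D) hτ hx
    obtain ⟨w, hw, -, rfl⟩ := exists_fixed_lift (D := D) hτ hy
    rw [← hTadd]; exact hfix (by rw [map_add, hz, hw])
  · intro c x hx
    obtain ⟨z, hz, -, rfl⟩ := exists_fixed_lift (D := D) hτ hx
    rw [← hTsmul]; exact hfix (by rw [map_smul, hz])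
  · intro x hx
    obtain ⟨z, hz, -, rfl⟩ := exists_fixed_lift (D := D) hτ hx
    rw [← T_star]; exact hfix (by rw [map_star, hz])
  · intro x hx y hy
    obtain ⟨z, hz, hz', rfl⟩ := exists_fixed_lift (D := D) hτ hx
    obtain ⟨w, hw, hw', rfl⟩ := exists_fixed_lift (D := D) hτ hy
    rw [prod_T hτ hz' hw']; exact hfix (by rw [map_mul, hz, hw])

end MinimalDilation

/-! ### Weighted averages of conjugations by isometries -/

section WeightedConjugation

variable {E : Type*} [NormedAddCommGroup E] [InnerProductSpace ℂ E] [CompleteSpace E]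
  {Θ : Type*}

/-- The map `x ↦ ∑ ω_i s_i^* x s_i` given by weights and operators `s_i`. -/
def weightedConj (ω : Θ → ℝ) (s : Θ → (E →L[ℂ] E)) (x : E →L[ℂ] E) : E →L[ℂ] E :=
  ∑' i, (ω i : ℂ) • (star (s i) * x * s i)

variable {ω : Θ → ℝ} {s : Θ → (E →L[ℂ] E)}

theorem norm_le_one_of_star_mul_self {a : E →L[ℂ] E} (ha : star a * a = 1) : ‖a‖ ≤ 1 := by
  have h1 : ‖a‖ * ‖a‖ ≤ 1 := by
    rw [← CStarRing.norm_star_mul_self, ha]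
    exact ContinuousLinearMap.norm_id_le
  nlinarith [norm_nonneg a]

theorem norm_weightedConj_term_le (hω : ∀ i, 0 < ω i) (hs : ∀ i, star (s i) * s i = 1)
    (x : E →L[ℂ] E) (i : Θ) : ‖(ω i : ℂ) • (star (s i) * x * s i)‖ ≤ ω i * ‖x‖ := by
  have h1 := norm_le_one_of_star_mul_self (hs i)
  rw [norm_smul, Complex.norm_real, Real.norm_of_nonneg (hω i).le]
  gcongr
  · exact (hω i).le
  calc ‖star (s i) * x * s i‖ ≤ ‖star (s i)‖ * ‖x‖ * ‖s i‖ :=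
        (norm_mul_le _ _).trans (by gcongr; exact norm_mul_le _ _)
    _ ≤ 1 * ‖x‖ * 1 := by rw [norm_star]; gcongr
    _ = ‖x‖ := by ring

variable (hω : ∀ i, 0 < ω i) (hs : ∀ i, star (s i) * s i = 1) (hsum : HasSum ω 1)
include hω hs hsum

theorem hasSum_weightedConj (x : E →L[ℂ] E) :
    HasSum (fun i => (ω i : ℂ) • (star (s i) * x * s i)) (weightedConj ω s x) :=
  (Summable.of_norm_bounded (hsum.summable.mul_right ‖x‖)
    (norm_weightedConj_term_le hω hs x)).hasSum

theorem norm_weightedConj_le (x : E →L[ℂ] E) : ‖weightedConj ω s x‖ ≤ ‖x‖ := by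
  have h := tsum_of_norm_bounded (hsum.mul_right ‖x‖) (norm_weightedConj_term_le hω hs x)
  rwa [one_mul] at h

theorem weightedConj_add (x y : E →L[ℂ] E) :
    weightedConj ω s (x + y) = weightedConj ω s x + weightedConj ω s y := by
  refine (hasSum_weightedConj hω hs hsum (x + y)).unique ?_
  convert (hasSum_weightedConj hω hs hsum x).add (hasSum_weightedConj hω hs hsum y) using 2
  rw [mul_add, add_mul, smul_add]

theorem weightedConj_smul (c : ℂ) (x : E →L[ℂ] E) :
    weightedConj ω s (c • x) = c • weightedConj ω s x := by
  refine (hasSum_weightedConj hω hs hsum (c • x)).unique ?_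
  convert (hasSum_weightedConj hω hs hsum x).const_smul c using 2
  rw [mul_smul_comm, smul_mul_assoc, smul_comm]

theorem weightedConj_sub (x y : E →L[ℂ] E) :
    weightedConj ω s (x - y) = weightedConj ω s x - weightedConj ω s y := by
  rw [eq_sub_iff_add_eq, ← weightedConj_add hω hs hsum, sub_add_cancel]

theorem weightedConj_star (x : E →L[ℂ] E) :
    weightedConj ω s (star x) = star (weightedConj ω s x) := by
  refine (hasSum_weightedConj hω hs hsum (star x)).unique ?_
  convert (hasSum_weightedConj hω hs hsum x).star using 2
  simp [mul_assoc]

theorem weightedConj_of_intertwine {x : E →L[ℂ] E} {c : ℂ}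
    (h : ∀ i, x * s i = c • (s i * x)) : weightedConj ω s x = c • x := by
  refine (hasSum_weightedConj hω hs hsum x).unique ?_
  have h1 : HasSum (fun i => (ω i : ℂ)) 1 := by
    simpa using Complex.hasSum_ofReal.2 hsum
  have h2 := h1.smul_const (c • x)
  rw [one_smul] at h2
  convert h2 using 2 with i
  rw [mul_assoc, h, mul_smul_comm, ← mul_assoc, hs, one_mul]

theorem weightedConj_one : weightedConj ω s 1 = 1 := by
  have := weightedConj_of_intertwine hω hs hsum (x := 1) (c := 1) (by simp)
  simpa using this

omit hs hsum in
theorem weightedConj_nonneg {x : E →L[ℂ] E} (hx : 0 ≤ x) : 0 ≤ weightedConj ω s x := by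
  refine tsum_nonneg fun i => ?_
  rw [Complex.coe_smul]
  exact smul_nonneg (hω i).le (star_left_conjugate_nonneg hx (s i))

theorem weightedConj_mono : Monotone (weightedConj ω s) := fun x y h => by
  rw [← sub_nonneg, ← weightedConj_sub hω hs hsum]
  exact weightedConj_nonneg hω (sub_nonneg.2 h)

/-- Kadison's inequality at a fixed point. -/
theorem star_mul_self_le_weightedConj {x : E →L[ℂ] E} (hx : weightedConj ω s x = x) :
    star x * x ≤ weightedConj ω s (star x * x) := by
  have hx' : weightedConj ω s (star x) = star x := by
    rw [weightedConj_star hω hs hsum, hx]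
  have h1 : HasSum (fun i => (ω i : ℂ)) 1 := by
    simpa using Complex.hasSum_ofReal.2 hsum
  have ha := hasSum_weightedConj hω hs hsum (star x * x)
  have hb := (hasSum_weightedConj hω hs hsum x).mul_left (star x)
  have hc := (hasSum_weightedConj hω hs hsum (star x)).mul_right x
  have hd := h1.smul_const (star x * x)
  -- Because `x` and `star x` are fixed, the cross sums are both `star x * x`, and the total is
  -- `τ(x^*x) - x^*x`; termwise it is `ω_i |x s_i - s_i x|²`.
  have key := ((ha.sub hb).sub hc).add hd
  rw [hx, hx', one_smul, sub_add_cancel] at key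
  rw [← sub_nonneg]
  refine key.nonneg fun i => ?_
  have h2 : (ω i : ℂ) • (star (s i) * (star x * x) * s i) -
      star x * ((ω i : ℂ) • (star (s i) * x * s i)) -
      (ω i : ℂ) • (star (s i) * star x * s i) * x + (ω i : ℂ) • (star x * x) =
      (ω i) • (star (x * s i - s i * x) * (x * s i - s i * x)) := by
    rw [← Complex.coe_smul, mul_smul_comm, smul_mul_assoc, ← smul_sub, ← smul_sub, ← smul_add]
    congr 1
    have h3 : star x * x = star x * (star (s i) * s i) * x := by rw [hs, mul_one]
    nth_rewrite 2 [h3]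
    rw [star_sub, star_mul, star_mul]
    noncomm_ring
  change 0 ≤ (ω i : ℂ) • (star (s i) * (star x * x) * s i) -
      star x * ((ω i : ℂ) • (star (s i) * x * s i)) -
      (ω i : ℂ) • (star (s i) * star x * s i) * x + (ω i : ℂ) • (star x * x)
  rw [h2]
  exact smul_nonneg (hω i).le (star_mul_self_nonneg _)

/-- Strong continuity on bounded sequences. -/
theorem tendstoSOT_weightedConj {x : ℕ → (E →L[ℂ] E)} {z : E →L[ℂ] E} {C : ℝ}
    (hC : ∀ n, ‖x n‖ ≤ C) (h : TendstoSOT x z) :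
    TendstoSOT (fun n => weightedConj ω s (x n)) (weightedConj ω s z) := by
  intro v
  have happ : ∀ y, weightedConj ω s y v = ∑' i, (ω i : ℂ) • star (s i) (y (s i v)) := fun y =>
    (((ContinuousLinearMap.apply ℂ E v).hasSum
      (hasSum_weightedConj hω hs hsum y)).tsum_eq).symm
  simp only [happ]
  refine tendsto_tsum_of_dominated_convergence (hsum.summable.mul_right (C * ‖v‖))
    (fun i => ?_) (Eventually.of_forall fun n i => ?_)
  · exact (((star (s i)).continuous.tendsto _).comp (h (s i v))).const_smul _
  · refine (((ω i : ℂ) • (star (s i) * x n * s i)).le_of_opNorm_le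
      ((norm_weightedConj_term_le hω hs (x n) i).trans ?_) v).trans_eq (mul_assoc _ C _)
    have := (hω i).le
    gcongr
    exact hC n

theorem norm_weightedConj_iterate_le (n : ℕ) (x : E →L[ℂ] E) :
    ‖(weightedConj ω s)^[n] x‖ ≤ ‖x‖ := by
  induction n with
  | zero => rfl
  | succ n ih =>
    rw [Function.iterate_succ_apply']
    exact (norm_weightedConj_le hω hs hsum _).trans ih

theorem exists_tendstoSOT_iterate_star_mul_self {x : E →L[ℂ] E} (hx : weightedConj ω s x = x) :
    ∃ p, TendstoSOT (fun n => (weightedConj ω s)^[n] (star x * x)) p :=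
  exists_tendstoSOT_of_monotone
    ((weightedConj_mono hω hs hsum).monotone_iterate_of_le_map
      (star_mul_self_le_weightedConj hω hs hsum hx))
    (norm_weightedConj_iterate_le hω hs hsum · _)

/-- The iterates on a product of two fixed points converge strongly to a fixed point. -/
theorem exists_tendstoSOT_iterate_mul {a b : E →L[ℂ] E} (ha : weightedConj ω s a = a)
    (hb : weightedConj ω s b = b) :
    ∃ p, weightedConj ω s p = p ∧ TendstoSOT (fun n => (weightedConj ω s)^[n] (a * b)) p := by
  set τ := weightedConj ω s with hτ
  have hadd : ∀ x y, τ (x + y) = τ x + τ y := weightedConj_add hω hs hsum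
  have hsmul : ∀ (c : ℂ) x, τ (c • x) = c • τ x := weightedConj_smul hω hs hsum
  let τₗ : (E →L[ℂ] E) →ₗ[ℂ] (E →L[ℂ] E) := ⟨⟨τ, hadd⟩, hsmul⟩
  have hpow : ∀ n x, τ^[n] x = (τₗ ^ n) x := fun n x => (Module.End.pow_apply τₗ n x).symm
  -- Polarization: `4ab` is the sum of `k (b + k a^*)^* (b + k a^*)` over `k = 1, -1, i, -i`, and
  -- each `b + k a^*` is a fixed point.
  have hfix : ∀ k : ℂ, ∃ p, TendstoSOT
      (fun n => τ^[n] (star (b + k • star a) * (b + k • star a))) p := fun k =>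
    exists_tendstoSOT_iterate_star_mul_self hω hs hsum (by
      rw [weightedConj_add hω hs hsum, weightedConj_smul hω hs hsum,
        weightedConj_star hω hs hsum, ← hτ, ha, hb])
  obtain ⟨p1, h1⟩ := hfix 1
  obtain ⟨p2, h2⟩ := hfix (-1)
  obtain ⟨p3, h3⟩ := hfix Complex.I
  obtain ⟨p4, h4⟩ := hfix (-Complex.I)
  have hpol : a * b = (4⁻¹ : ℂ) • (star (b + (1 : ℂ) • star a) * (b + (1 : ℂ) • star a)) +
      (-4⁻¹ : ℂ) • (star (b + (-1 : ℂ) • star a) * (b + (-1 : ℂ) • star a)) +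
      (4⁻¹ * Complex.I : ℂ) • (star (b + Complex.I • star a) * (b + Complex.I • star a)) +
      (-(4⁻¹ * Complex.I) : ℂ) •
        (star (b + (-Complex.I) • star a) * (b + (-Complex.I) • star a)) := by
    simp only [star_add, star_smul, star_star, add_mul, mul_add, smul_mul_assoc, mul_smul_comm,
      smul_add, smul_smul, star_neg, star_one, Complex.star_def, Complex.conj_I]
    match_scalars <;> ring_nf <;> simp <;> ring_nf
  obtain ⟨p, hp⟩ : ∃ p, TendstoSOT (fun n => τ^[n] (a * b)) p := by
    have h := (((h1.const_smul 4⁻¹).add (h2.const_smul (-4⁻¹))).add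
      (h3.const_smul (4⁻¹ * Complex.I))).add (h4.const_smul (-(4⁻¹ * Complex.I)))
    refine ⟨_, fun v => (h v).congr fun n => ?_⟩
    rw [hpol]
    simp only [hpow, map_add, map_smul]
  refine ⟨p, ?_, hp⟩
  -- Applying the map to the bounded sequence only shifts it by one, so its limit is fixed.
  have h5 := tendstoSOT_weightedConj hω hs hsum
    (norm_weightedConj_iterate_le hω hs hsum · (a * b)) hp
  refine h5.unique fun v => ?_
  simp only [← hτ, ← Function.iterate_succ_apply']
  exact (hp v).comp (tendsto_add_atTop_nat 1)

end WeightedConjugation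

/-! ### Creation and phase operators on the Fock space -/

section Fock

variable {H : Type u} [NormedAddCommGroup H] [InnerProductSpace ℂ H]

theorem norm_creation_apply (ξ : H) (η : Fock H) : ‖creation ξ η‖ = ‖ξ‖ * ‖η‖ := by
  have h1 : HasSum (fun n => ‖creation ξ η n‖ ^ 2) (‖creation ξ η‖ ^ 2) := by
    simpa using lp.hasSum_norm (p := 2) (by norm_num) (creation ξ η)
  have h2 := h1.unique (hasSum_creationFun ξ η)
  rw [← mul_pow] at h2
  exact (pow_left_inj₀ (norm_nonneg _) (by positivity) two_ne_zero).1 h2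

theorem star_creation_mul_self {ξ : H} (hξ : ‖ξ‖ = 1) :
    star (creation ξ) * creation ξ = 1 :=
  (ContinuousLinearMap.norm_map_iff_adjoint_comp_self _).1 fun η => by
    rw [norm_creation_apply, hξ, one_mul]

theorem phase_mul_phase (c d : Circle) :
    (phase c * phase d : Fock H →L[ℂ] Fock H) = phase (c * d) := by
  ext η n
  change (c : ℂ) ^ n • (d : ℂ) ^ n • η n = ((c * d : Circle) : ℂ) ^ n • η n
  rw [smul_smul, Circle.coe_mul, mul_pow]

theorem vacuum_ne_zero : Fock.vacuum H ≠ 0 := by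
  intro h
  have h1 : (EuclideanSpace.single PUnit.unit (1 : ℂ) : EuclideanSpace ℂ PUnit.{u + 1}) = 0 :=
    (lp.single_apply_self (E := fun n => (tensorPow H n).carrier) 2 0 _).symm.trans
      (congrArg (fun η : Fock H => η 0) h)
  simp at h1

theorem phase_ne_zero (c : Circle) : (phase c : Fock H →L[ℂ] Fock H) ≠ 0 := fun h => by
  have h1 := phase_vacuum (H := H) c
  rw [h] at h1
  exact vacuum_ne_zero h1.symm

variable {Θ : Type*} {e : HilbertBasis Θ ℂ H} {ω : Θ → ℝ}

theorem phase_mem_peripheralEigenspace (hω : ∀ i, 0 < ω i) (hsum : HasSum ω 1) (c : Circle) :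
    (phase c : Fock H →L[ℂ] Fock H) ∈ peripheralEigenspace (fockMap e ω) c :=
  weightedConj_of_intertwine hω (fun i => star_creation_mul_self (e.orthonormal.1 i)) hsum
    fun i => ContinuousLinearMap.ext fun η => phase_creation c (e i) η

end Fock

end

theorem lemma3 {H : Type u} [NormedAddCommGroup H] [InnerProductSpace ℂ H] [CompleteSpace H]
    {Θ : Type*} [Countable Θ] [Nontrivial Θ] (e : HilbertBasis Θ ℂ H)
    (ω : Θ → ℝ) (hω : ∀ i, 0 < ω i) (hsum : HasSum ω 1) :
    -- eigenvector identity
    (∀ c : Circle, c ≠ 1 →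
      fockMap e ω (phase c) = (c : ℂ) • (phase c : Fock H →L[ℂ] Fock H)) ∧
    -- products: the operator product, the strong limit, the product from any minimal dilation
    (∀ c d : Circle, c ≠ 1 → d ≠ 1 →
      (phase c * phase d : Fock H →L[ℂ] Fock H) = phase (c * d) ∧
      TendstoSOT (fun n => ((c : ℂ) * (d : ℂ))⁻¹ ^ n • (fockMap e ω)^[n] (phase c * phase d))
        (phase c * phase d) ∧
      ∀ D : MinimalDilation.{u, v} (Fock H) (fockMap e ω),
        D.prod (phase c) (phase d) = phase c * phase d) ∧
    -- strictness
    (∀ c : Circle, c ≠ 1 →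
      (phase c : Fock H →L[ℂ] Fock H) ∈ peripheralBoundary (fockMap e ω) ∧
      (phase c : Fock H →L[ℂ] Fock H) ∉ poissonBoundary (fockMap e ω)) ∧
    poissonBoundary (fockMap e ω) ⊂
      (peripheralBoundary (fockMap e ω) : Set (Fock H →L[ℂ] Fock H)) ∧
    -- the Choi-Effros product of two fixed points exists, is a fixed point, and is the product
    -- from any minimal dilation
    (∀ a ∈ poissonBoundary (fockMap e ω), ∀ b ∈ poissonBoundary (fockMap e ω),
      ∃ p ∈ poissonBoundary (fockMap e ω),
        TendstoSOT (fun n => (fockMap e ω)^[n] (a * b)) p ∧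
        ∀ D : MinimalDilation.{u, v} (Fock H) (fockMap e ω), D.prod a b = p) ∧
    -- C*-subalgebra
    (∀ D : MinimalDilation.{u, v} (Fock H) (fockMap e ω),
      Set.BijOn D.T D.boundary (peripheralBoundary (fockMap e ω)) ∧
      (∀ z ∈ D.boundary, ‖D.T z‖ = ‖z‖) ∧
      IsUnitalCStarAlgebra (peripheralBoundary (fockMap e ω)) D.prod ∧
      IsUnitalCStarSubalgebra (poissonBoundary (fockMap e ω))
        (peripheralBoundary (fockMap e ω)) D.prod)
 := by
  have hs : ∀ i, star (creation (e i)) * creation (e i) = 1 := fun i =>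
    star_creation_mul_self (e.orthonormal.1 i)
  -- `fockMap e ω` is by definition `weightedConj ω` for the isometries `creation (e i)`.
  have hone : fockMap e ω 1 = 1 := weightedConj_one hω hs hsum
  have hphase : ∀ c, (phase c : Fock H →L[ℂ] Fock H) ∈ peripheralEigenspace (fockMap e ω) c :=
    phase_mem_peripheralEigenspace hω hsum
  have hiter : ∀ c d : Circle, ∀ n : ℕ, ((c : ℂ) * (d : ℂ))⁻¹ ^ n •
      (fockMap e ω)^[n] (phase c * phase d) = (phase c * phase d : Fock H →L[ℂ] Fock H) := by
    intro c d n
    have h := smul_iterate_of_mem_peripheralEigenspace (τ := fockMap e ω)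
      (weightedConj_smul hω hs hsum) (hphase (c * d)) n
    rw [phase_mul_phase, h, smul_smul, Circle.coe_mul, ← mul_pow,
      inv_mul_cancel₀ (mul_ne_zero (Circle.coe_ne_zero c) (Circle.coe_ne_zero d)), one_pow,
      one_smul]
  have hlim : ∀ c d : Circle, TendstoSOT (fun n => ((c : ℂ) * (d : ℂ))⁻¹ ^ n •
      (fockMap e ω)^[n] (phase c * phase d)) (phase c * phase d : Fock H →L[ℂ] Fock H) := by
    intro c d
    simp only [hiter]
    exact fun v => tendsto_const_nhds
  have hnotmem : ∀ c : Circle, c ≠ 1 →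
      (phase c : Fock H →L[ℂ] Fock H) ∉ poissonBoundary (fockMap e ω) := by
    intro c hc h
    have h1 : (c : ℂ) • (phase c : Fock H →L[ℂ] Fock H) = (1 : ℂ) • phase c := by
      rw [one_smul]; exact (hphase c).symm.trans h
    exact hc (Circle.ext (smul_left_injective ℂ (phase_ne_zero c) h1))
  have hmem : ∀ c : Circle,
      (phase c : Fock H →L[ℂ] Fock H) ∈ peripheralBoundary (fockMap e ω) := fun c =>
    peripheralEigenspace_subset_boundary _ c (hphase c)
  refine ⟨fun c _ => hphase c, fun c d _ _ => ⟨phase_mul_phase c d, hlim c d, fun D => ?_⟩,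
    fun c hc => ⟨hmem c, hnotmem c hc⟩, ?_, ?_, fun D => ⟨MinimalDilation.T_bijOn hone,
      fun z hz => MinimalDilation.norm_T_eq hone hz, MinimalDilation.isUnitalCStarAlgebra hone,
      MinimalDilation.isUnitalCStarSubalgebra hone⟩⟩
  · exact (MinimalDilation.tendstoSOT_prod hone (hphase c) (hphase d)).unique (hlim c d)
  · refine (Set.ssubset_iff_of_subset ?_).2 ⟨phase (-1), hmem _, hnotmem _ ?_⟩
    · rw [← peripheralEigenspace_one]
      exact peripheralEigenspace_subset_boundary _ 1
    · intro h
      have h1 := congrArg (fun c : Circle => (c : ℂ).re) h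
      norm_num at h1
  · intro a ha b hb
    obtain ⟨p, hp, hlim⟩ := exists_tendstoSOT_iterate_mul hω hs hsum ha hb
    refine ⟨p, hp, hlim, fun D => ?_⟩
    -- Fixed points are eigenvectors for the eigenvalue `1`, so the rotation factor disappears and
    -- uniqueness of strong limits applies.
    rw [← peripheralEigenspace_one] at ha hb
    have h := MinimalDilation.tendstoSOT_prod (D := D) hone ha hb
    simp only [Circle.coe_one, mul_one, inv_one, one_pow, one_smul] at h
    exact h.unique hlim
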